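/- Let $N\ge 0$ and consider $x_{k+1}=A_kx_k+B_ku_k+w_k$, $y_k=C_kx_k+v_k$ with $x_k\in\mathbb R^n$, $u_k\in\mathbb R^m$, $y_k\in\mathbb R^p$, where $x_0\sim\mathcal N(m_0,M_0)$, $w_k\sim\mathcal N(0,W_k)$, $v_k\sim\mathcal N(0,V_k)$ are mutually independent, $M_0\succ0$, $W_k\succ0$, $V_k\succ0$. Let $Q_k\succeq0$, $R_k\succ0$, $\theta_k\in\mathbb R$, and define $S_{N+1}=Q_{N+1}$, $\Gamma_{N+1}=0$ and, for $k\le N$, $$\Gamma_k=A_k^TS_{k+1}B_k(B_k^TS_{k+1}B_k+R_k)^{-1}B_k^TS_{k+1}A_k,\quad S_k=Q_k+A_k^TS_{k+1}A_k-\Gamma_k,\quad L_k=(B_k^TS_{k+1}B_k+R_k)^{-1}B_k^TS_{k+1}A_k .$$ At time $k$ an event trigger that knows $\mathcal I^e_k=\{y_0,\dots,y_k\}$ chooses $\delta_k\in\{0,1\}$; if $\delta_k=1$, then $y_k$ is sent to the controller with one step of delay. The controller discards the information contained in non-transmission; its estimator is $$\hat x_{k+1}=A_k\hat x_k+B_ku_k+\delta_kK_k\nu_k,\qquad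 \nu_k=y_k-C_k\hat x_k,\qquad K_k=A_kP_kC_k^T(C_kP_kC_k^T+V_k)^{-1},$$ $$P_{k+1}=A_kP_kA_k^T+W_k-\delta_kK_kC_kP_kA_k^T,\qquad \hat x_0=m_0,\quad P_0=M_0,$$ and it applies the certainty-equivalence policy $\mu^*$: $u_k=-L_k\hat x_k$. The event trigger runs the Kalman filter $$\check x_{k}=\check x_k^-+\Sigma_kC_k^TV_k^{-1}(y_k-C_k\check x_k^-),\quad \check x_0^-=m_0,\quad \check x_{k+1}^-=A_k\check x_k+B_ku_k,$$ $$\Sigma_0=(M_0^{-1}+C_0^TV_0^{-1}C_0)^{-1},\quad \Sigma_{k+1}=\big((A_k\Sigma_kA_k^T+W_k)^{-1}+C_{k+1}^TV_{k+1}^{-1}C_{k+1}\big)^{-1}.$$ Let $\varepsilon_k=\check x_k-\hat x_k$, and for a triggering policy $\pi$ let $$\Psi(\pi,\mu^*)=\mathsf E\Big[x_{N+1}^TQ_{N+1}x_{N+1}+\sum_{k=0}^N\big(x_k^TQ_kx_k+u_k^TR_ku_k+\theta_k\delta_k\big)\Big].$$ Let $\bar\pi$ be the periodic policy of period $1$ ($\delta_k=1$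 for all $k$), and let $\pi^+$ be the policy $\delta_k^+=\mathbf 1_{\mathrm{VoI}^{\bar\pi}_k\ge0}$, $0\le k\le N$, with $$\mathrm{VoI}^{\bar\pi}_k=\nu_k^TK_k^T\Gamma_{k+1}(2A_k\varepsilon_k-K_k\nu_k)-\theta_k+\sum_{t=k+2}^N\big(\bar e_t^{0T}\Gamma_t\bar e_t^0+\operatorname{tr}(\Gamma_t\bar P_t^0)\big)-\sum_{t=k+2}^N\big(\bar e_t^{1T}\Gamma_t\bar e_t^1+\operatorname{tr}(\Gamma_t\bar P_t^1)\big),$$ where, for $i\in\{0,1\}$ and $t\ge k+1$, with $K_t^i=A_tP_t^iC_t^T(C_tP_t^iC_t^T+V_t)^{-1}$, $$\bar e_{t+1}^i=(A_t-K_t^iC_t)\bar e_t^i,\qquad \bar P_{t+1}^i=(A_t-K_t^iC_t)\bar P_t^i(A_t-K_t^iC_t)^T+W_t+K_t^iV_tK_t^{iT},$$ $$P_{t+1}^i=A_tP_t^iA_t^T+W_t-K_t^iC_tP_t^iA_t^T,$$ $$\bar e^0_{k+1}=A_k\varepsilon_k,\quad \bar e^1_{k+1}=A_k\varepsilon_k-K_k\nu_k,\quad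 \bar P^0_{k+1}=\bar P^1_{k+1}=A_k\Sigma_kA_k^T+W_k,$$ $$P^0_{k+1}=A_kP_kA_k^T+W_k,\quad P^1_{k+1}=A_kP_kA_k^T+W_k-K_kC_kP_kA_k^T .$$ Then the following hold. (1) In the closed loop under $(\pi^+,\mu^*)$, for $0\le k\le N$, $x_k$ is square integrable and, almost surely, $\check x_k=\mathsf E[x_k\mid\mathcal I^e_k]$ and $\Sigma_k=\mathsf{Cov}[x_k\mid\mathcal I^e_k]$. (2) For $0\le k\le N$, $\delta^+_k$ is a measurable function of $\mathcal I^e_k$, and $\mathrm{VoI}^{\bar\pi}_k$ is the value of information of the rollout algorithm with base policy $\bar\pi$: almost surely $$\mathrm{VoI}_k^{\bar\pi}=\nu_k^TK_k^T\Gamma_{k+1}(2A_k\varepsilon_k-K_k\nu_k)-\theta_k+\mathsf E[V^{\bar\pi}_{k+1}\mid\mathcal I^e_k,\delta_k=0]-\mathsf E[V^{\bar\pi}_{k+1}\mid\mathcal I^e_k,\delta_k=1],$$ where $V^{\bar\pi}_{k+1}=\sum_{t=k+1}^N\big(\theta_t\delta_t+(x_{t+1}-\hat x_{t+1})^T\Gamma_{t+1}(x_{t+1}-\hat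 x_{t+1})\big)$ is evaluated, for each of the two values of $\delta_k$, in the closed loop that follows $\pi^+$ before time $k$, takes that decision at time $k$ and follows $\bar\pi$ from time $k+1$ on; it is integrable in both cases. (3) $\pi^+$ outperforms $\bar\pi$: both costs are finite expectations of integrable random variables, and $\Psi(\pi^+,\mu^*)\le\Psi(\bar\pi,\mu^*)$. -/

import Mathlib

open MeasureTheory ProbabilityTheory
open scoped Matrix

noncomputable section

namespace EventTriggered

/-- Data of the finite-horizon event-triggered LQG problem: state dimension `n`, input dimension
`m`, output dimension `p`, horizon `N`; `θ k` is the price of a transmission at time `k`. -/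
structure LQGSystem (n m p : ℕ) where
  N : ℕ
  A : ℕ → Matrix (Fin n) (Fin n) ℝ
  B : ℕ → Matrix (Fin n) (Fin m) ℝ
  C : ℕ → Matrix (Fin p) (Fin n) ℝ
  W : ℕ → Matrix (Fin n) (Fin n) ℝ
  V : ℕ → Matrix (Fin p) (Fin p) ℝ
  Q : ℕ → Matrix (Fin n) (Fin n) ℝ
  R : ℕ → Matrix (Fin m) (Fin m) ℝ
  θ : ℕ → ℝ
  m₀ : Fin n → ℝ
  M₀ : Matrix (Fin n) (Fin n) ℝ

namespace LQGSystem

variable {n m p : ℕ} (sys : LQGSystem n m p)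

/-- The definiteness conditions on covariances and weights. -/
structure WellPosed : Prop where
  posDef_W : ∀ k, (sys.W k).PosDef
  posDef_V : ∀ k, (sys.V k).PosDef
  posDef_M₀ : sys.M₀.PosDef
  posSemidef_Q : ∀ k, (sys.Q k).PosSemidef
  posDef_R : ∀ k, (sys.R k).PosDef

/-! ### Riccati equation of the control problem -/

/-- `A_kᵀ S B_k (B_kᵀ S B_k + R_k)⁻¹ B_kᵀ S A_k`, where `S` stands for `S_{k+1}`. -/
def gammaOf (k : ℕ) (S : Matrix (Fin n) (Fin n) ℝ) : Matrix (Fin n) (Fin n) ℝ :=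
  (sys.A k)ᵀ * S * sys.B k * ((sys.B k)ᵀ * S * sys.B k + sys.R k)⁻¹ * (sys.B k)ᵀ * S * sys.A k

/-- The Riccati solution in reversed time: `riccatiRev j` is `S_{N+1-j}`. -/
def riccatiRev : ℕ → Matrix (Fin n) (Fin n) ℝ
  | 0 => sys.Q (sys.N + 1)
  | j + 1 =>
    sys.Q (sys.N - j) + (sys.A (sys.N - j))ᵀ * riccatiRev j * sys.A (sys.N - j)
      - sys.gammaOf (sys.N - j) (riccatiRev j)

/-- The matrix `S_k`, for `k ≤ N + 1`. -/
def S (k : ℕ) : Matrix (Fin n) (Fin n) ℝ := sys.riccatiRev (sys.N + 1 - k)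

/-- The matrix `Γ_k`, with `Γ_{N+1} = 0`. -/
def Γ (k : ℕ) : Matrix (Fin n) (Fin n) ℝ :=
  if k ≤ sys.N then sys.gammaOf k (sys.S (k + 1)) else 0

/-- The certainty-equivalence gain `L_k`. -/
def L (k : ℕ) : Matrix (Fin m) (Fin n) ℝ :=
  ((sys.B k)ᵀ * sys.S (k + 1) * sys.B k + sys.R k)⁻¹ * (sys.B k)ᵀ * sys.S (k + 1) * sys.A k

/-! ### Filters -/

/-- Covariance `Σ_k` of the filter at the event trigger. -/
def Sig : ℕ → Matrix (Fin n) (Fin n) ℝ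
  | 0 => (sys.M₀⁻¹ + (sys.C 0)ᵀ * (sys.V 0)⁻¹ * sys.C 0)⁻¹
  | k + 1 =>
    ((sys.A k * Sig k * (sys.A k)ᵀ + sys.W k)⁻¹
      + (sys.C (k + 1))ᵀ * (sys.V (k + 1))⁻¹ * sys.C (k + 1))⁻¹

/-- Gain `H_k` of the filter at the event trigger. -/
def H (k : ℕ) : Matrix (Fin n) (Fin p) ℝ := sys.Sig k * (sys.C k)ᵀ * (sys.V k)⁻¹

/-- Gain `A_k P C_kᵀ (C_k P C_kᵀ + V_k)⁻¹` of the estimator at the controller, as a function of the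
covariance `P` at time `k`. -/
def K (k : ℕ) (P : Matrix (Fin n) (Fin n) ℝ) : Matrix (Fin n) (Fin p) ℝ :=
  sys.A k * P * (sys.C k)ᵀ * (sys.C k * P * (sys.C k)ᵀ + sys.V k)⁻¹

/-- Covariance step of the estimator at the controller, where `d` tells whether `y_k` is
transmitted. -/
def covStep (k : ℕ) (d : Bool) (P : Matrix (Fin n) (Fin n) ℝ) : Matrix (Fin n) (Fin n) ℝ :=
  sys.A k * P * (sys.A k)ᵀ + sys.W k
    - if d then sys.K k P * sys.C k * P * (sys.A k)ᵀ else 0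

end LQGSystem

/-- What the event trigger has computed from the outputs `y_0, …, y_k` when it decides at time `k`:
the controller estimate `x̂_k` and covariance `P_k`, its own estimate `x̌_k`, and the current
output `y_k`. -/
structure Info (n p : ℕ) where
  xhat : Fin n → ℝ
  P : Matrix (Fin n) (Fin n) ℝ
  xchk : Fin n → ℝ
  y : Fin p → ℝ

/-- A triggering policy: the decision `δ_k` (`true` means that `y_k` is transmitted). -/
abbrev Policy (n p : ℕ) := ℕ → Info n p → Bool

/-- Joint state of plant and filters at one time. -/
structure LoopState (n p : ℕ) where
  x : Fin n → ℝ
  info : Info n p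

namespace LQGSystem

variable {n m p : ℕ} (sys : LQGSystem n m p)

/-- The certainty-equivalence control `u_k = -L_k x̂_k`. -/
def control (k : ℕ) (s : Info n p) : Fin m → ℝ := -(sys.L k *ᵥ s.xhat)

/-- Innovation `ν_k = y_k - C_k x̂_k`. -/
def nu (k : ℕ) (s : Info n p) : Fin p → ℝ := s.y - sys.C k *ᵥ s.xhat

/-- Closed loop under triggering policy `π` and the certainty-equivalence control, driven by the
initial state `x0`, the process noise `w` and the measurement noise `v`. -/
def loop (π : Policy n p) (x0 : Fin n → ℝ) (w : ℕ → Fin n → ℝ) (v : ℕ → Fin p → ℝ) :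
    ℕ → LoopState n p
  | 0 =>
    let y := sys.C 0 *ᵥ x0 + v 0
    { x := x0
      info :=
        { xhat := sys.m₀
          P := sys.M₀
          xchk := sys.m₀ + sys.H 0 *ᵥ (y - sys.C 0 *ᵥ sys.m₀)
          y := y } }
  | k + 1 =>
    let s := loop π x0 w v k
    let d := π k s.info
    let u := sys.control k s.info
    let x' := sys.A k *ᵥ s.x + sys.B k *ᵥ u + w k
    let y' := sys.C (k + 1) *ᵥ x' + v (k + 1)
    let pred := sys.A k *ᵥ s.info.xchk + sys.B k *ᵥ u
    { x := x'
      info :=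
        { xhat := sys.A k *ᵥ s.info.xhat + sys.B k *ᵥ u
            + if d then sys.K k s.info.P *ᵥ sys.nu k s.info else 0
          P := sys.covStep k d s.info.P
          xchk := pred + sys.H (k + 1) *ᵥ (y' - sys.C (k + 1) *ᵥ pred)
          y := y' } }

/-! ### The closed-form triggering rule -/

/-- Mean, covariance and controller covariance `(ē, P̄, P)` at time `t₀ + j`, started from `init` at
time `t₀` and propagated as if every output were transmitted. -/
def propag (t₀ : ℕ)
    (init : (Fin n → ℝ) × Matrix (Fin n) (Fin n) ℝ × Matrix (Fin n) (Fin n) ℝ) :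
    ℕ → (Fin n → ℝ) × Matrix (Fin n) (Fin n) ℝ × Matrix (Fin n) (Fin n) ℝ
  | 0 => init
  | j + 1 =>
    let e := (propag t₀ init j).1
    let Pbar := (propag t₀ init j).2.1
    let P := (propag t₀ init j).2.2
    let t := t₀ + j
    let Kt := sys.K t P
    let F := sys.A t - Kt * sys.C t
    (F *ᵥ e, F * Pbar * Fᵀ + sys.W t + Kt * sys.V t * Ktᵀ,
      sys.A t * P * (sys.A t)ᵀ + sys.W t - Kt * sys.C t * P * (sys.A t)ᵀ)

/-- The sum over `k + 2 ≤ t ≤ N` of `ē_tᵀ Γ_t ē_t + tr (Γ_t P̄_t)`, for a propagation that starts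
from `init` at time `k + 1`. -/
def tailSum (k : ℕ)
    (init : (Fin n → ℝ) × Matrix (Fin n) (Fin n) ℝ × Matrix (Fin n) (Fin n) ℝ) : ℝ :=
  ∑ t ∈ Finset.Icc (k + 2) sys.N,
    ((sys.propag (k + 1) init (t - (k + 1))).1 ⬝ᵥ
        (sys.Γ t *ᵥ (sys.propag (k + 1) init (t - (k + 1))).1)
      + (sys.Γ t * (sys.propag (k + 1) init (t - (k + 1))).2.1).trace)

/-- Mismatch estimation error `ε_k = x̌_k - x̂_k`. -/
def eps (s : Info n p) : Fin n → ℝ := s.xchk - s.xhat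

/-- Initial condition of the propagation at time `k + 1` in the case `δ_k = 0`. -/
def init0 (k : ℕ) (s : Info n p) :
    (Fin n → ℝ) × Matrix (Fin n) (Fin n) ℝ × Matrix (Fin n) (Fin n) ℝ :=
  (sys.A k *ᵥ eps s,
    sys.A k * sys.Sig k * (sys.A k)ᵀ + sys.W k,
    sys.A k * s.P * (sys.A k)ᵀ + sys.W k)

/-- Initial condition of the propagation at time `k + 1` in the case `δ_k = 1`. -/
def init1 (k : ℕ) (s : Info n p) :
    (Fin n → ℝ) × Matrix (Fin n) (Fin n) ℝ × Matrix (Fin n) (Fin n) ℝ :=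
  (sys.A k *ᵥ eps s - sys.K k s.P *ᵥ sys.nu k s,
    sys.A k * sys.Sig k * (sys.A k)ᵀ + sys.W k,
    sys.A k * s.P * (sys.A k)ᵀ + sys.W k - sys.K k s.P * sys.C k * s.P * (sys.A k)ᵀ)

/-- The part `ν_kᵀ K_kᵀ Γ_{k+1} (2 A_k ε_k - K_k ν_k) - θ_k` of the value of information. -/
def voiBase (k : ℕ) (s : Info n p) : ℝ :=
  (sys.K k s.P *ᵥ sys.nu k s) ⬝ᵥ
      (sys.Γ (k + 1) *ᵥ ((2 : ℝ) • (sys.A k *ᵥ eps s) - sys.K k s.P *ᵥ sys.nu k s))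
    - sys.θ k

/-- The closed-form value of information. -/
def voi (k : ℕ) (s : Info n p) : ℝ :=
  sys.voiBase k s + sys.tailSum k (sys.init0 k s) - sys.tailSum k (sys.init1 k s)

/-- The policy `δ_k⁺ = 1` if and only if the value of information is nonnegative. -/
def rolloutPolicy : Policy n p := fun k s => decide (0 ≤ sys.voi k s)

/-- The periodic policy with period `kp`; for `kp = 1` every output is transmitted. -/
def periodicPolicy (n p kp : ℕ) : Policy n p := fun k _ => decide (kp ∣ k)

/-- Follow `π` before time `k`, take the decision `d` at time `k`, and follow `base` afterwards. -/
def deviate (π base : Policy n p) (k : ℕ) (d : Bool) : Policy n p :=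
  fun t s => if t < k then π t s else if t = k then d else base t s

/-! ### Probabilistic notions -/

variable {Ω : Type*} [MeasurableSpace Ω]

/-- `x0`, `w`, `v` are a Gaussian initial state and Gaussian white noises with the prescribed means
and covariances, all mutually independent. -/
structure IsNoise (P : Measure Ω) (x0 : Ω → Fin n → ℝ) (w : ℕ → Ω → Fin n → ℝ)
    (v : ℕ → Ω → Fin p → ℝ) : Prop where
  measurable_x0 : Measurable x0
  measurable_w : ∀ k, Measurable (w k)
  measurable_v : ∀ k, Measurable (v k)
  law_x0 : HasLaw (fun ω => WithLp.toLp 2 (x0 ω))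
    (multivariateGaussian (WithLp.toLp 2 sys.m₀) sys.M₀) P
  law_w : ∀ k, HasLaw (fun ω => WithLp.toLp 2 (w k ω)) (multivariateGaussian 0 (sys.W k)) P
  law_v : ∀ k, HasLaw (fun ω => WithLp.toLp 2 (v k ω)) (multivariateGaussian 0 (sys.V k)) P
  indep_x0 : IndepFun x0 (fun ω k => (w k ω, v k ω)) P
  indep_wv : ∀ k, IndepFun (w k) (v k) P
  indep_time : iIndepFun (fun k ω => (w k ω, v k ω)) P

/-- The closed-loop process on the sample space. -/
def run (π : Policy n p) (x0 : Ω → Fin n → ℝ) (w : ℕ → Ω → Fin n → ℝ) (v : ℕ → Ω → Fin p → ℝ)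
    (k : ℕ) (ω : Ω) : LoopState n p :=
  sys.loop π (x0 ω) (fun t => w t ω) (fun t => v t ω) k

/-- The information of the event trigger at time `k`: the σ-algebra generated by the outputs
`y_0, …, y_k`. -/
abbrev outputSigma (π : Policy n p) (x0 : Ω → Fin n → ℝ) (w : ℕ → Ω → Fin n → ℝ)
    (v : ℕ → Ω → Fin p → ℝ) (k : ℕ) : MeasurableSpace Ω :=
  MeasurableSpace.comap
    (fun ω (t : Fin (k + 1)) => (sys.run π x0 w v t ω).info.y) inferInstance

/-- The realized cost of a closed loop, whose expectation is `Ψ(π, μ*)`. -/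
def cost (π : Policy n p) (x0 : Ω → Fin n → ℝ) (w : ℕ → Ω → Fin n → ℝ)
    (v : ℕ → Ω → Fin p → ℝ) (ω : Ω) : ℝ :=
  let r := fun k => sys.run π x0 w v k ω
  let u := fun k => sys.control k (r k).info
  (r (sys.N + 1)).x ⬝ᵥ (sys.Q (sys.N + 1) *ᵥ (r (sys.N + 1)).x)
    + ∑ k ∈ Finset.range (sys.N + 1),
        ((r k).x ⬝ᵥ (sys.Q k *ᵥ (r k).x) + u k ⬝ᵥ (sys.R k *ᵥ u k)
          + sys.θ k * if π k (r k).info then 1 else 0)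

/-- The sum over `k + 1 ≤ t ≤ N` of `θ_t δ_t + e_{t+1}ᵀ Γ_{t+1} e_{t+1}` along the closed loop under
`π`, where `e_t = x_t - x̂_t`. -/
def costToGo (π : Policy n p) (x0 : Ω → Fin n → ℝ) (w : ℕ → Ω → Fin n → ℝ)
    (v : ℕ → Ω → Fin p → ℝ) (k : ℕ) (ω : Ω) : ℝ :=
  let r := fun k => sys.run π x0 w v k ω
  let e := fun k => (r k).x - (r k).info.xhat
  ∑ t ∈ Finset.Icc (k + 1) sys.N,
    ((sys.θ t * if π t (r t).info then 1 else 0) + e (t + 1) ⬝ᵥ (sys.Γ (t + 1) *ᵥ e (t + 1)))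

/-- The approximation of the future term of the value of information at time `k` along `π`: the
difference, between the decisions `δ_k = 0` and `δ_k = 1`, of the conditional expectations of the
cost-to-go when the policy `base` is followed from time `k + 1` on. -/
def rolloutRho (P : Measure Ω) (π base : Policy n p) (x0 : Ω → Fin n → ℝ)
    (w : ℕ → Ω → Fin n → ℝ) (v : ℕ → Ω → Fin p → ℝ) (k : ℕ) : Ω → ℝ :=
  P[sys.costToGo (deviate π base k false) x0 w v k | sys.outputSigma π x0 w v k]
    - P[sys.costToGo (deviate π base k true) x0 w v k | sys.outputSigma π x0 w v k]

end LQGSystem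

end EventTriggered

end

open EventTriggered LQGSystem

/-! The policy enters the cost only through prices and estimation errors. Completing squares with
the Riccati matrices writes the cost, path by path, as a policy-free part (`fixedLoss`), plus
`triggerLoss` = Σ (θ_t δ_t + e_{t+1}ᵀ Γ_{t+1} e_{t+1}) with e = x - x̂, plus products of w_k with
quantities determined before w_k acts (`cost_eq`). The products have mean zero, so two policies
compare as their expected trigger losses do (`integral_cost`).

The two policies are joined by the hybrids `switch π⁺ π̄ k`, which decide by the value of
information before time k and always transmit from then on. Consecutive hybrids differ only on the
event {VoI_k < 0}, which is known at time k. The conditional expectation of the loss of not sending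
minus the loss of sending is exactly VoI_k (`condExp_triggerLoss_sub`), so each passage from k to k
+ 1 can only lower the expected loss.

That VoI_k has the stated closed form rests on two facts. The outputs are not Gaussian in general,
since decisions depend on them nonlinearly; but the filter error x - x̌ obeys a linear recursion
free of the policy, and an innovation argument shows it to be centred Gaussian, independent of the
outputs, with covariance Σ_k (`filterOK`). Once the decision at time k is fixed and all later
outputs are sent, the later gains are known at time k, so the conditional mean and covariance of e
propagate linearly as in `propag` (`centredCond_error`). Two moments suffice, the loss being
quadratic.

Integrability is cheap: the covariance P_k takes finitely many values, so the gains are bounded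
(`exists_finite_cov`). -/

namespace EventTriggered.LQGSystem

variable {n m p : ℕ} {sys : LQGSystem n m p}

/-! ### Algebra of the Riccati equation -/

lemma dotProduct_mulVec_mul {ι κ l : Type*} [Fintype ι] [Fintype κ] [Fintype l]
    (F : Matrix ι κ ℝ) (G : Matrix ι l ℝ) (x : κ → ℝ) (y : l → ℝ) :
    (F *ᵥ x) ⬝ᵥ (G *ᵥ y) = x ⬝ᵥ ((Fᵀ * G) *ᵥ y) := by
  rw [← Matrix.mulVec_mulVec, Matrix.dotProduct_mulVec x, Matrix.vecMul_transpose]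

lemma dotProduct_mulVec_comm {ι : Type*} [Fintype ι] {M : Matrix ι ι ℝ} (hM : Mᵀ = M)
    (x y : ι → ℝ) : x ⬝ᵥ (M *ᵥ y) = y ⬝ᵥ (M *ᵥ x) := by
  rw [Matrix.dotProduct_mulVec, ← Matrix.mulVec_transpose, hM, dotProduct_comm]

/-- The matrix `B_kᵀ S B_k + R_k`. -/
def inputWeight (sys : LQGSystem n m p) (k : ℕ) (S : Matrix (Fin n) (Fin n) ℝ) :
    Matrix (Fin m) (Fin m) ℝ :=
  (sys.B k)ᵀ * S * sys.B k + sys.R k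

/-- The feedback gain `(B_kᵀ S B_k + R_k)⁻¹ B_kᵀ S A_k`. -/
noncomputable def gainOf (sys : LQGSystem n m p) (k : ℕ) (S : Matrix (Fin n) (Fin n) ℝ) :
    Matrix (Fin m) (Fin n) ℝ :=
  (sys.inputWeight k S)⁻¹ * (sys.B k)ᵀ * S * sys.A k

lemma posDef_inputWeight (hsys : sys.WellPosed) (k : ℕ) {S : Matrix (Fin n) (Fin n) ℝ}
    (hS : S.PosSemidef) : (sys.inputWeight k S).PosDef := by
  have h := hS.conjTranspose_mul_mul_same (sys.B k)
  rw [Matrix.conjTranspose_eq_transpose_of_trivial] at h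
  exact Matrix.PosDef.posSemidef_add h (hsys.posDef_R k)

lemma inputWeight_mul_gainOf (hsys : sys.WellPosed) (k : ℕ) {S : Matrix (Fin n) (Fin n) ℝ}
    (hS : S.PosSemidef) :
    sys.inputWeight k S * sys.gainOf k S = (sys.B k)ᵀ * S * sys.A k := by
  have h := (posDef_inputWeight hsys k hS).isUnit
  rw [Matrix.isUnit_iff_isUnit_det] at h
  simp only [gainOf, Matrix.mul_assoc]
  rw [Matrix.mul_nonsing_inv_cancel_left _ _ h]

lemma transpose_eq_of_posSemidef {ι : Type*} {S : Matrix ι ι ℝ} (hS : S.PosSemidef) : Sᵀ = S := by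
  simpa using hS.isHermitian.eq

/-- The form LᵀML, with M the input weight, makes symmetry visible and turns Γ-weighted errors into
squares of input deviations. -/
lemma gammaOf_eq (hsys : sys.WellPosed) (k : ℕ) {S : Matrix (Fin n) (Fin n) ℝ}
    (hS : S.PosSemidef) :
    sys.gammaOf k S = (sys.gainOf k S)ᵀ * sys.inputWeight k S * sys.gainOf k S := by
  rw [Matrix.mul_assoc, inputWeight_mul_gainOf hsys k hS]
  have h := transpose_eq_of_posSemidef hS
  have h' := transpose_eq_of_posSemidef (posDef_inputWeight hsys k hS).posSemidef
  simp only [gammaOf, gainOf, Matrix.transpose_mul, Matrix.transpose_nonsing_inv, h, h',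
    Matrix.transpose_transpose, Matrix.mul_assoc]
  simp only [inputWeight, Matrix.mul_assoc]

/-- In closed-loop form the recursion reads Q + (A - BL)ᵀS(A - BL) + LᵀRL, a sum of positive
semidefinite terms. -/
lemma posSemidef_riccatiRev (hsys : sys.WellPosed) (j : ℕ) : (sys.riccatiRev j).PosSemidef := by
  induction j with
  | zero => exact hsys.posSemidef_Q _
  | succ j ih =>
    simp only [riccatiRev]
    set k := sys.N - j
    set S := sys.riccatiRev j
    have hG := inputWeight_mul_gainOf hsys k ih
    have h := transpose_eq_of_posSemidef ih
    set L := sys.gainOf k S with hL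
    have key : sys.Q k + (sys.A k)ᵀ * S * sys.A k - sys.gammaOf k S
        = sys.Q k + (sys.A k - sys.B k * L)ᵀ * S * (sys.A k - sys.B k * L)
          + Lᵀ * sys.R k * L := by
      have e1 : sys.gammaOf k S = Lᵀ * ((sys.B k)ᵀ * S * sys.A k) := by
        rw [gammaOf_eq hsys k ih, Matrix.mul_assoc, hG]
      have e2 : sys.gammaOf k S = Lᵀ * (sys.inputWeight k S * L) := by
        rw [gammaOf_eq hsys k ih, Matrix.mul_assoc]
      have e3 : sys.gammaOf k S = (sys.A k)ᵀ * S * sys.B k * L := by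
        have : ((sys.B k)ᵀ * S * sys.A k)ᵀ = (sys.A k)ᵀ * S * sys.B k := by
          simp [Matrix.transpose_mul, h, Matrix.mul_assoc]
        have hs : (sys.gammaOf k S)ᵀ = sys.gammaOf k S := by
          rw [gammaOf_eq hsys k ih]
          simp [Matrix.transpose_mul, Matrix.mul_assoc,
            transpose_eq_of_posSemidef (posDef_inputWeight hsys k ih).posSemidef]
        rw [← hs, e1, Matrix.transpose_mul, this, Matrix.transpose_transpose]
      have e4 : Lᵀ * (sys.inputWeight k S * L)
          = Lᵀ * (sys.B k)ᵀ * S * sys.B k * L + Lᵀ * sys.R k * L := by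
        simp [inputWeight, Matrix.mul_add, Matrix.add_mul, Matrix.mul_assoc]
      have e5 : (sys.A k - sys.B k * L)ᵀ * S * (sys.A k - sys.B k * L)
          = (sys.A k)ᵀ * S * sys.A k - (sys.A k)ᵀ * S * sys.B k * L
            - Lᵀ * ((sys.B k)ᵀ * S * sys.A k) + Lᵀ * (sys.B k)ᵀ * S * sys.B k * L := by
        simp [Matrix.mul_sub, Matrix.sub_mul, Matrix.mul_assoc]
        abel
      -- Both cross terms equal Γ, and the two terms quadratic in L add up to Γ; the net
      -- contribution is a single -Γ.
      rw [e5, ← e3, ← e1]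
      nth_rewrite 1 [e2]
      rw [e4, ← sub_eq_zero]
      have := e4.symm.trans e2.symm
      rw [← this]
      abel
    rw [key]
    have h1 := ih.conjTranspose_mul_mul_same (sys.A k - sys.B k * L)
    have h2 := (hsys.posDef_R k).posSemidef.conjTranspose_mul_mul_same L
    rw [Matrix.conjTranspose_eq_transpose_of_trivial] at h1 h2
    exact ((hsys.posSemidef_Q k).add h1).add h2

lemma posSemidef_S (hsys : sys.WellPosed) (k : ℕ) : (sys.S k).PosSemidef :=
  posSemidef_riccatiRev hsys _

lemma S_eq {k : ℕ} (hk : k ≤ sys.N) :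
    sys.S k = sys.Q k + (sys.A k)ᵀ * sys.S (k + 1) * sys.A k - sys.Γ k := by
  -- With k ≤ N no subtraction is truncated, so reversed time translates back exactly.
  have h1 : sys.N + 1 - k = (sys.N - k) + 1 := by omega
  have h2 : sys.N - (sys.N - k) = k := by omega
  have h3 : sys.N + 1 - (k + 1) = sys.N - k := by omega
  simp only [S, Γ, h1, h3, if_pos hk, riccatiRev, h2]

lemma S_terminal : sys.S (sys.N + 1) = sys.Q (sys.N + 1) := by simp [S, riccatiRev]

lemma Γ_eq (hsys : sys.WellPosed) {k : ℕ} (hk : k ≤ sys.N) :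
    sys.Γ k = (sys.L k)ᵀ * sys.inputWeight k (sys.S (k + 1)) * sys.L k := by
  rw [Γ, if_pos hk, gammaOf_eq hsys k (posSemidef_S hsys _)]
  rfl

lemma Γ_terminal : sys.Γ (sys.N + 1) = 0 := by simp [Γ]

lemma transpose_Γ (hsys : sys.WellPosed) (k : ℕ) : (sys.Γ k)ᵀ = sys.Γ k := by
  by_cases hk : k ≤ sys.N
  · rw [Γ_eq hsys hk]
    simp [Matrix.transpose_mul, Matrix.mul_assoc,
      transpose_eq_of_posSemidef (posDef_inputWeight hsys k (posSemidef_S hsys _)).posSemidef]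
  · simp [Γ, hk]

/-- Completion of squares in one step of the dynamics. -/
lemma stage_cost_eq (hsys : sys.WellPosed) {k : ℕ} (hk : k ≤ sys.N) (x xhat w : Fin n → ℝ)
    (u : Fin m → ℝ) (hu : u = -(sys.L k *ᵥ xhat)) :
    (sys.A k *ᵥ x + sys.B k *ᵥ u + w) ⬝ᵥ
        (sys.S (k + 1) *ᵥ (sys.A k *ᵥ x + sys.B k *ᵥ u + w))
      + (x ⬝ᵥ (sys.Q k *ᵥ x) + u ⬝ᵥ (sys.R k *ᵥ u))
    = x ⬝ᵥ (sys.S k *ᵥ x) + (x - xhat) ⬝ᵥ (sys.Γ k *ᵥ (x - xhat))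
      + w ⬝ᵥ (sys.S (k + 1) *ᵥ w)
      + 2 * (w ⬝ᵥ (sys.S (k + 1) *ᵥ (sys.A k *ᵥ x + sys.B k *ᵥ u))) := by
  have hS := posSemidef_S hsys (k + 1)
  set S := sys.S (k + 1)
  have hc := dotProduct_mulVec_comm (transpose_eq_of_posSemidef hS)
  have hML : sys.inputWeight k S * sys.L k = (sys.B k)ᵀ * S * sys.A k :=
    inputWeight_mul_gainOf hsys k hS
  have hMc := dotProduct_mulVec_comm
    (transpose_eq_of_posSemidef (posDef_inputWeight hsys k hS).posSemidef)
  -- Certainty equivalence: the applied input misses the state feedback -Lx by L(x - x̂), so the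
  -- completed square in u is a Γ-weighted estimation error.
  have hΓ : (x - xhat) ⬝ᵥ (sys.Γ k *ᵥ (x - xhat))
      = (u + sys.L k *ᵥ x) ⬝ᵥ (sys.inputWeight k S *ᵥ (u + sys.L k *ᵥ x)) := by
    have : u + sys.L k *ᵥ x = sys.L k *ᵥ (x - xhat) := by
      rw [hu, Matrix.mulVec_sub]; abel
    rw [this, Γ_eq hsys hk, Matrix.mulVec_mulVec, dotProduct_mulVec_mul, ← Matrix.mul_assoc]
  have e1 : ∀ z, u ⬝ᵥ (sys.inputWeight k S *ᵥ z)
      = (sys.B k *ᵥ u) ⬝ᵥ (S *ᵥ (sys.B k *ᵥ z)) + u ⬝ᵥ (sys.R k *ᵥ z) := by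
    intro z
    rw [inputWeight, Matrix.add_mulVec, dotProduct_add, Matrix.mulVec_mulVec,
      dotProduct_mulVec_mul, Matrix.mul_assoc]
  have e2 : u ⬝ᵥ (sys.inputWeight k S *ᵥ (sys.L k *ᵥ x))
      = (sys.B k *ᵥ u) ⬝ᵥ (S *ᵥ (sys.A k *ᵥ x)) := by
    rw [Matrix.mulVec_mulVec, hML, Matrix.mulVec_mulVec, dotProduct_mulVec_mul, Matrix.mul_assoc]
  have e3 : (sys.L k *ᵥ x) ⬝ᵥ (sys.inputWeight k S *ᵥ (sys.L k *ᵥ x))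
      = x ⬝ᵥ (sys.Γ k *ᵥ x) := by
    rw [Γ_eq hsys hk, Matrix.mulVec_mulVec, dotProduct_mulVec_mul, ← Matrix.mul_assoc]
  have e4 : x ⬝ᵥ (sys.S k *ᵥ x) = x ⬝ᵥ (sys.Q k *ᵥ x)
      + (sys.A k *ᵥ x) ⬝ᵥ (S *ᵥ (sys.A k *ᵥ x)) - x ⬝ᵥ (sys.Γ k *ᵥ x) := by
    rw [S_eq hk, Matrix.sub_mulVec, Matrix.add_mulVec, dotProduct_sub, dotProduct_add,
      Matrix.mulVec_mulVec, dotProduct_mulVec_mul, Matrix.mul_assoc]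
  rw [hΓ, e4]
  simp only [Matrix.mulVec_add, dotProduct_add, add_dotProduct, e2, e3,
    hMc (sys.L k *ᵥ x) u, e1 u]
  rw [hc (sys.A k *ᵥ x) (sys.B k *ᵥ u), hc (sys.A k *ᵥ x) w, hc (sys.B k *ᵥ u) w]
  ring

end EventTriggered.LQGSystem

namespace EventTriggered

/-! ### Measurability of matrix-valued maps -/

section MatrixMeasurability

variable {α ι κ l : Type*} [MeasurableSpace α]

instance : MeasurableSpace (Matrix ι κ ℝ) := inferInstanceAs (MeasurableSpace (ι → κ → ℝ))

lemma measurable_matrix_iff {F : α → Matrix ι κ ℝ} :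
    Measurable F ↔ ∀ i j, Measurable fun a => F a i j := by
  refine ⟨fun h i j => ?_, fun h => ?_⟩
  · exact (measurable_pi_apply j).comp ((measurable_pi_apply (X := fun _ : ι => κ → ℝ) i).comp h)
  · exact measurable_pi_lambda (X := fun _ : ι => κ → ℝ) _ fun i =>
      measurable_pi_lambda _ fun j => h i j

lemma measurable_matrix_add {F G : α → Matrix ι κ ℝ} (hF : Measurable F) (hG : Measurable G) :
    Measurable fun a => F a + G a := by
  rw [measurable_matrix_iff] at *
  exact fun i j => (hF i j).add (hG i j)

lemma measurable_matrix_sub {F G : α → Matrix ι κ ℝ} (hF : Measurable F) (hG : Measurable G) :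
    Measurable fun a => F a - G a := by
  rw [measurable_matrix_iff] at *
  exact fun i j => (hF i j).sub (hG i j)

lemma measurable_matrix_transpose {F : α → Matrix ι κ ℝ} (hF : Measurable F) :
    Measurable fun a => (F a)ᵀ := by
  rw [measurable_matrix_iff] at *
  exact fun i j => hF j i

lemma measurable_matrix_mul [Fintype κ] {F : α → Matrix ι κ ℝ} {G : α → Matrix κ l ℝ}
    (hF : Measurable F) (hG : Measurable G) : Measurable fun a => F a * G a := by
  rw [measurable_matrix_iff] at *
  intro i j
  simp only [Matrix.mul_apply]
  exact Finset.measurable_sum _ fun k _ => (hF i k).mul (hG k j)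

lemma measurable_mulVec [Fintype κ] {F : α → Matrix ι κ ℝ} {x : α → κ → ℝ}
    (hF : Measurable F) (hx : Measurable x) : Measurable fun a => F a *ᵥ x a := by
  rw [measurable_matrix_iff] at hF
  refine measurable_pi_lambda _ fun i => ?_
  simp only [Matrix.mulVec, dotProduct]
  exact Finset.measurable_sum _ fun k _ => (hF i k).mul ((measurable_pi_apply k).comp hx)

lemma measurable_dotProduct [Fintype κ] {x y : α → κ → ℝ} (hx : Measurable x)
    (hy : Measurable y) : Measurable fun a => x a ⬝ᵥ y a := by
  simp only [dotProduct]
  exact Finset.measurable_sum _ fun k _ =>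
    ((measurable_pi_apply k).comp hx).mul ((measurable_pi_apply k).comp hy)

lemma measurable_matrix_trace [Fintype κ] {F : α → Matrix κ κ ℝ} (hF : Measurable F) :
    Measurable fun a => (F a).trace := by
  rw [measurable_matrix_iff] at hF
  simp only [Matrix.trace, Matrix.diag]
  exact Finset.measurable_sum _ fun k _ => hF k k

lemma measurable_matrix_det [Fintype κ] [DecidableEq κ] {F : α → Matrix κ κ ℝ}
    (hF : Measurable F) : Measurable fun a => (F a).det := by
  rw [measurable_matrix_iff] at hF
  simp only [Matrix.det_apply]
  exact Finset.measurable_sum _ fun σ _ =>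
    (Finset.measurable_prod _ fun k _ => hF (σ k) k).const_smul _

/-- Cramer's rule: each entry is (det)⁻¹ times a determinant with one row replaced. With 0⁻¹ = 0
this also covers singular matrices, so no invertibility is assumed. -/
lemma measurable_matrix_inv [Fintype κ] [DecidableEq κ] {F : α → Matrix κ κ ℝ}
    (hF : Measurable F) : Measurable fun a => (F a)⁻¹ := by
  have hd := measurable_matrix_det hF
  rw [measurable_matrix_iff] at *
  intro i j
  simp only [Matrix.inv_def, Ring.inverse_eq_inv', Matrix.smul_apply, smul_eq_mul,
    Matrix.adjugate_apply]
  refine hd.inv.mul (measurable_matrix_det (measurable_matrix_iff.2 fun k l => ?_))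
  by_cases hk : k = j
  · subst hk; simp
  · simp only [Matrix.updateRow_ne hk]; exact hF k l

end MatrixMeasurability

/-! ### Measurability of the data held by the event trigger. -/

section InfoMeasurability

variable {α : Type*} [MeasurableSpace α] {n p : ℕ}

instance : MeasurableSpace (Info n p) :=
  MeasurableSpace.comap (fun s => (s.xhat, s.P, s.xchk, s.y)) inferInstance

lemma measurable_info_iff {s : α → Info n p} :
    Measurable s ↔ Measurable (fun a => (s a).xhat) ∧ Measurable (fun a => (s a).P) ∧
      Measurable (fun a => (s a).xchk) ∧ Measurable fun a => (s a).y := by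
  rw [measurable_comap_iff]
  constructor
  · intro h
    exact ⟨h.fst, h.snd.fst, h.snd.snd.fst, h.snd.snd.snd⟩
  · rintro ⟨h1, h2, h3, h4⟩
    exact h1.prodMk (h2.prodMk (h3.prodMk h4))

end InfoMeasurability

namespace LQGSystem

variable {n m p : ℕ} (sys : LQGSystem n m p)

/-! ### Measurability of gains, forecasts, value of information and closed loop. -/

section Measurability

variable {α : Type*} [MeasurableSpace α]

lemma measurable_K (k : ℕ) {P : α → Matrix (Fin n) (Fin n) ℝ} (hP : Measurable P) :
    Measurable fun a => sys.K k (P a) :=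
  measurable_matrix_mul
    (measurable_matrix_mul (measurable_matrix_mul measurable_const hP) measurable_const)
    (measurable_matrix_inv (measurable_matrix_add
      (measurable_matrix_mul (measurable_matrix_mul measurable_const hP) measurable_const)
      measurable_const))

lemma measurable_propag (t₀ : ℕ)
    {init : α → (Fin n → ℝ) × Matrix (Fin n) (Fin n) ℝ × Matrix (Fin n) (Fin n) ℝ}
    (h : Measurable init) (j : ℕ) : Measurable fun a => sys.propag t₀ (init a) j := by
  induction j with
  | zero => exact h
  | succ j ih =>
    simp only [propag]
    have hP := ih.snd.snd
    have hK := measurable_K sys (t₀ + j) hP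
    have hF : Measurable fun a => sys.A (t₀ + j)
        - sys.K (t₀ + j) (sys.propag t₀ (init a) j).2.2 * sys.C (t₀ + j) :=
      measurable_matrix_sub measurable_const (measurable_matrix_mul hK measurable_const)
    refine (measurable_mulVec hF ih.fst).prodMk (Measurable.prodMk ?_ ?_)
    · exact measurable_matrix_add (measurable_matrix_add (measurable_matrix_mul
        (measurable_matrix_mul hF ih.snd.fst) (measurable_matrix_transpose hF)) measurable_const)
        (measurable_matrix_mul (measurable_matrix_mul hK measurable_const)
          (measurable_matrix_transpose hK))
    · exact measurable_matrix_sub (measurable_matrix_add (measurable_matrix_mul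
        (measurable_matrix_mul measurable_const hP) measurable_const) measurable_const)
        (measurable_matrix_mul (measurable_matrix_mul (measurable_matrix_mul hK measurable_const)
          hP) measurable_const)

lemma measurable_tailSum (k : ℕ)
    {init : α → (Fin n → ℝ) × Matrix (Fin n) (Fin n) ℝ × Matrix (Fin n) (Fin n) ℝ}
    (h : Measurable init) : Measurable fun a => sys.tailSum k (init a) := by
  refine Finset.measurable_sum _ fun t _ => ?_
  have hp := measurable_propag sys (k + 1) h (t - (k + 1))
  exact (measurable_dotProduct hp.fst (measurable_mulVec measurable_const hp.fst)).add
    (measurable_matrix_trace (measurable_matrix_mul measurable_const hp.snd.fst))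

lemma measurable_nu (k : ℕ) {s : α → Info n p} (hs : Measurable s) :
    Measurable fun a => sys.nu k (s a) := by
  obtain ⟨h1, -, -, h4⟩ := measurable_info_iff.1 hs
  exact h4.sub (measurable_mulVec measurable_const h1)

lemma measurable_eps {s : α → Info n p} (hs : Measurable s) :
    Measurable fun a => eps (s a) := by
  obtain ⟨h1, -, h3, -⟩ := measurable_info_iff.1 hs
  exact h3.sub h1

lemma measurable_init0 (k : ℕ) {s : α → Info n p} (hs : Measurable s) :
    Measurable fun a => sys.init0 k (s a) := by
  obtain ⟨-, h2, -, -⟩ := measurable_info_iff.1 hs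
  refine (measurable_mulVec measurable_const (measurable_eps hs)).prodMk
    (measurable_const.prodMk ?_)
  exact measurable_matrix_add (measurable_matrix_mul (measurable_matrix_mul measurable_const h2)
    measurable_const) measurable_const

lemma measurable_init1 (k : ℕ) {s : α → Info n p} (hs : Measurable s) :
    Measurable fun a => sys.init1 k (s a) := by
  obtain ⟨-, h2, -, -⟩ := measurable_info_iff.1 hs
  have hK := measurable_K sys k h2
  refine ((measurable_mulVec measurable_const (measurable_eps hs)).sub
    (measurable_mulVec hK (measurable_nu sys k hs))).prodMk (measurable_const.prodMk ?_)
  exact measurable_matrix_sub (measurable_matrix_add (measurable_matrix_mul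
    (measurable_matrix_mul measurable_const h2) measurable_const) measurable_const)
    (measurable_matrix_mul (measurable_matrix_mul (measurable_matrix_mul hK measurable_const) h2)
      measurable_const)

lemma measurable_voi (k : ℕ) : Measurable (sys.voi k) := by
  have hs : Measurable (id : Info n p → Info n p) := measurable_id
  obtain ⟨-, h2, -, -⟩ := measurable_info_iff.1 hs
  have hKν := measurable_mulVec (measurable_K sys k h2) (measurable_nu sys k hs)
  have h2A : Measurable fun s : Info n p => (2 : ℝ) • (sys.A k *ᵥ eps s) :=
    Measurable.const_smul (measurable_mulVec measurable_const (measurable_eps hs)) (2 : ℝ)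
  refine Measurable.sub (Measurable.add (Measurable.sub (measurable_dotProduct hKν
    (measurable_mulVec measurable_const (h2A.sub hKν))) measurable_const)
    (measurable_tailSum sys k (measurable_init0 sys k hs)))
    (measurable_tailSum sys k (measurable_init1 sys k hs))

lemma measurable_rolloutPolicy (k : ℕ) : Measurable (sys.rolloutPolicy k) :=
  measurable_to_bool (by
    have : sys.rolloutPolicy k ⁻¹' {true} = sys.voi k ⁻¹' Set.Ici 0 := by
      ext s; simp [rolloutPolicy]
    rw [this]
    exact measurable_voi sys k measurableSet_Ici)

lemma measurable_periodicPolicy (kp k : ℕ) : Measurable (periodicPolicy n p kp k) :=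
  measurable_const

lemma measurable_deviate {π base : Policy n p} (hπ : ∀ k, Measurable (π k))
    (hbase : ∀ k, Measurable (base k)) (k : ℕ) (d : Bool) (t : ℕ) :
    Measurable (deviate π base k d t) := by
  unfold deviate
  by_cases h1 : t < k
  · simpa [h1] using hπ t
  by_cases h2 : t = k
  · simp [h2]
  · simpa [h1, h2] using hbase t

/-- The information of the event trigger at time `k + 1`, as a function of the decision and the
information at time `k`, and of the next output. -/
noncomputable def nextInfo (k : ℕ) (d : Bool) (s : Info n p) (y : Fin p → ℝ) : Info n p where
  xhat := sys.A k *ᵥ s.xhat + sys.B k *ᵥ sys.control k s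
    + if d then sys.K k s.P *ᵥ sys.nu k s else 0
  P := sys.covStep k d s.P
  xchk := sys.A k *ᵥ s.xchk + sys.B k *ᵥ sys.control k s
    + sys.H (k + 1) *ᵥ (y - sys.C (k + 1) *ᵥ (sys.A k *ᵥ s.xchk + sys.B k *ᵥ sys.control k s))
  y := y

lemma measurable_bool_ite {β : Type*} [MeasurableSpace β] {d : α → Bool} (hd : Measurable d)
    {f g : α → β} (hf : Measurable f) (hg : Measurable g) :
    Measurable fun a => if d a then f a else g a :=
  Measurable.ite (hd (measurableSet_singleton true)) hf hg

lemma measurable_control (k : ℕ) {s : α → Info n p} (hs : Measurable s) :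
    Measurable fun a => sys.control k (s a) :=
  (measurable_mulVec measurable_const (measurable_info_iff.1 hs).1).neg

lemma measurable_nextInfo (k : ℕ) {d : α → Bool} {s : α → Info n p} {y : α → Fin p → ℝ}
    (hd : Measurable d) (hs : Measurable s) (hy : Measurable y) :
    Measurable fun a => sys.nextInfo k (d a) (s a) (y a) := by
  obtain ⟨h1, h2, h3, h4⟩ := measurable_info_iff.1 hs
  have hu := measurable_control sys k hs
  have hBu : Measurable fun a => sys.B k *ᵥ sys.control k (s a) :=
    measurable_mulVec measurable_const hu
  have hK := measurable_K sys k h2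
  have hpred : Measurable fun a => sys.A k *ᵥ (s a).xchk + sys.B k *ᵥ sys.control k (s a) :=
    (measurable_mulVec measurable_const h3).add hBu
  refine measurable_info_iff.2 ⟨?_, ?_, ?_, hy⟩
  · exact ((measurable_mulVec measurable_const h1).add hBu).add
      (measurable_bool_ite hd (measurable_mulVec hK (measurable_nu sys k hs)) measurable_const)
  · exact measurable_matrix_sub (measurable_matrix_add (measurable_matrix_mul
      (measurable_matrix_mul measurable_const h2) measurable_const) measurable_const)
      (measurable_bool_ite hd (measurable_matrix_mul (measurable_matrix_mul
        (measurable_matrix_mul hK measurable_const) h2) measurable_const) measurable_const)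
  · exact hpred.add (measurable_mulVec measurable_const
      (hy.sub (measurable_mulVec measurable_const hpred)))

variable {π : Policy n p} {x0 : α → Fin n → ℝ} {w : ℕ → α → Fin n → ℝ} {v : ℕ → α → Fin p → ℝ}

/-- State and noises reach the filters only through the outputs. The σ-algebra on the domain is left
arbitrary, so that the lemma can later be applied with the σ-algebras generated by outputs. -/
lemma measurable_info_of_outputs (hπ : ∀ k, Measurable (π k)) (k : ℕ)
    (hy : ∀ t ≤ k, Measurable fun a => (sys.run π x0 w v t a).info.y) :
    Measurable fun a => (sys.run π x0 w v k a).info := by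
  induction k with
  | zero =>
    have h0 := hy 0 le_rfl
    refine measurable_info_iff.2 ⟨measurable_const, measurable_const, ?_, h0⟩
    exact measurable_const.add (measurable_mulVec measurable_const (h0.sub measurable_const))
  | succ k ih =>
    have hs := ih fun t ht => hy t (ht.trans k.le_succ)
    -- One step of `loop` is by definition `nextInfo` at the new output.
    exact measurable_nextInfo sys k ((hπ k).comp hs) hs (hy (k + 1) le_rfl)

/-- The index ranges record causality: time k involves w before k but v up to and including k,
because y_k contains v_k. -/
lemma measurable_run (hπ : ∀ k, Measurable (π k)) (k : ℕ) (hx0 : Measurable x0)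
    (hw : ∀ t < k, Measurable (w t)) (hv : ∀ t ≤ k, Measurable (v t)) :
    Measurable (fun a => (sys.run π x0 w v k a).x) ∧
      Measurable fun a => (sys.run π x0 w v k a).info := by
  suffices h : ∀ j ≤ k, Measurable (fun a => (sys.run π x0 w v j a).x) ∧
      ∀ t ≤ j, Measurable fun a => (sys.run π x0 w v t a).info.y by
    exact ⟨(h k le_rfl).1, measurable_info_of_outputs sys hπ k (h k le_rfl).2⟩
  intro j
  induction j with
  | zero =>
    intro _
    refine ⟨hx0, fun t ht => ?_⟩
    obtain rfl : t = 0 := by omega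
    exact (measurable_mulVec measurable_const hx0).add (hv 0 (Nat.zero_le _))
  | succ j ih =>
    intro hj
    obtain ⟨hx, hy⟩ := ih (by omega)
    have hs := measurable_info_of_outputs sys hπ j hy
    have hx' : Measurable fun a => (sys.run π x0 w v (j + 1) a).x :=
      ((measurable_mulVec measurable_const hx).add
        (measurable_mulVec measurable_const (measurable_control sys j hs))).add (hw j (by omega))
    refine ⟨hx', fun t ht => ?_⟩
    obtain ht | rfl : t ≤ j ∨ t = j + 1 := by omega
    · exact hy t ht
    · exact (measurable_mulVec measurable_const hx').add (hv (j + 1) hj)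

end Measurability

/-! ### Dependence of the closed loop on the policy -/

/-- Agreement is asked only along the trajectory of `π`. This allows comparison with a policy that
hard-codes the decision which happens to be taken on a given path. -/
lemma loop_congr {π π' : Policy n p} {x0 : Fin n → ℝ} {w : ℕ → Fin n → ℝ} {v : ℕ → Fin p → ℝ}
    (k : ℕ) (h : ∀ t < k, π t (sys.loop π x0 w v t).info = π' t (sys.loop π x0 w v t).info) :
    sys.loop π x0 w v k = sys.loop π' x0 w v k := by
  induction k with
  | zero => rfl
  | succ k ih =>
    have ih := ih fun t ht => h t (by omega)
    have hk := h k (by omega)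
    simp only [loop]
    rw [hk, ih]

/-- Each step has two possible updates, so one finite set serves all policies and noises. It gives
uniform bounds on the gains without any estimate of the Riccati recursion. -/
lemma exists_finite_cov (k : ℕ) : ∃ T : Set (Matrix (Fin n) (Fin n) ℝ), T.Finite ∧
    ∀ (π : Policy n p) x0 w v, (sys.loop π x0 w v k).info.P ∈ T := by
  induction k with
  | zero => exact ⟨{sys.M₀}, Set.finite_singleton _, fun _ _ _ _ => rfl⟩
  | succ k ih =>
    obtain ⟨T, hT, h⟩ := ih
    exact ⟨Set.image2 (sys.covStep k) Set.univ T, Set.finite_univ.image2 _ hT,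
      fun π x0 w v => Set.mem_image2_of_mem (Set.mem_univ _) (h π x0 w v)⟩

/-- The same input drives the state and the estimate, so it cancels from the error. -/
lemma error_succ (π : Policy n p) (x0 : Fin n → ℝ) (w : ℕ → Fin n → ℝ) (v : ℕ → Fin p → ℝ)
    (k : ℕ) : (sys.loop π x0 w v (k + 1)).x - (sys.loop π x0 w v (k + 1)).info.xhat
      = sys.A k *ᵥ ((sys.loop π x0 w v k).x - (sys.loop π x0 w v k).info.xhat) + w k
        - if π k (sys.loop π x0 w v k).info then
            sys.K k (sys.loop π x0 w v k).info.P *ᵥ sys.nu k (sys.loop π x0 w v k).info else 0 := by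
  simp only [loop, Matrix.mulVec_sub]
  abel

lemma loop_y (π : Policy n p) (x0 : Fin n → ℝ) (w : ℕ → Fin n → ℝ) (v : ℕ → Fin p → ℝ)
    (k : ℕ) : (sys.loop π x0 w v k).info.y = sys.C k *ᵥ (sys.loop π x0 w v k).x + v k := by
  cases k <;> rfl

end LQGSystem

end EventTriggered

namespace EventTriggered

/-! ### Conditionally centred random vectors -/

section CondMoments

variable {Ω : Type*} {𝓜 mΩ : MeasurableSpace Ω} {P : Measure Ω} {ι κ : Type*}

/-- A matrix-valued map with bounded entries. -/
def BddMat (F : Ω → Matrix κ ι ℝ) : Prop := ∃ c : ℝ, ∀ ω i j, |F ω i j| ≤ c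

lemma bddMat_of_finite [Finite ι] [Finite κ] {β : Type*} {T : Set β} (hT : T.Finite)
    (g : β → Matrix κ ι ℝ) {s : Ω → β} (hs : ∀ ω, s ω ∈ T) : BddMat fun ω => g (s ω) := by
  have hfin : (⋃ i, ⋃ j, (fun M => |g M i j|) '' T).Finite :=
    Set.finite_iUnion fun i => Set.finite_iUnion fun j => hT.image _
  obtain ⟨c, hc⟩ := hfin.bddAbove
  exact ⟨c, fun ω i j => hc (Set.mem_iUnion.2 ⟨i, Set.mem_iUnion.2 ⟨j, s ω, hs ω, rfl⟩⟩)⟩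

lemma bddMat_const [Finite ι] [Finite κ] (M : Matrix κ ι ℝ) : BddMat fun _ : Ω => M :=
  bddMat_of_finite (Set.finite_singleton ()) (fun _ => M) (s := fun _ => ()) fun _ => rfl

lemma memLp_bdd_mul {f g : Ω → ℝ} (hf : Measurable f) {c : ℝ} (hc : ∀ ω, |f ω| ≤ c)
    (hg : MemLp g 2 P) : MemLp (fun ω => f ω * g ω) 2 P :=
  hg.of_le_mul (c := c) (hf.aestronglyMeasurable.mul hg.1) (.of_forall fun ω => by
    rw [norm_mul]; exact mul_le_mul_of_nonneg_right (hc ω) (norm_nonneg _))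

lemma memLp_mulVec [Fintype ι] {F : Ω → Matrix κ ι ℝ} {X : Ω → ι → ℝ} (hF : Measurable F)
    (hb : BddMat F) (hX : ∀ i, MemLp (fun ω => X ω i) 2 P) (i : κ) :
    MemLp (fun ω => (F ω *ᵥ X ω) i) 2 P := by
  obtain ⟨c, hc⟩ := hb
  simp only [Matrix.mulVec, dotProduct]
  exact memLp_finsetSum _ fun j _ =>
    memLp_bdd_mul (measurable_matrix_iff.1 hF i j) (fun ω => hc ω i j) (hX j)

lemma memLp_const_mulVec [Fintype ι] [Finite κ] (F : Matrix κ ι ℝ) {X : Ω → ι → ℝ}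
    (hX : ∀ i, MemLp (fun ω => X ω i) 2 P) (i : κ) : MemLp (fun ω => (F *ᵥ X ω) i) 2 P :=
  memLp_mulVec measurable_const (bddMat_const F) hX i

lemma integrable_dotProduct [Fintype ι] {X Y : Ω → ι → ℝ}
    (hX : ∀ i, MemLp (fun ω => X ω i) 2 P) (hY : ∀ i, MemLp (fun ω => Y ω i) 2 P) :
    Integrable (fun ω => X ω ⬝ᵥ Y ω) P := by
  simp only [dotProduct]
  exact integrable_finsetSum _ fun i _ => (hX i).integrable_mul (hY i)

/-- Known coefficients are pulled out term by term; the conditional moments of linear and quadratic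
expressions below reduce to this. -/
lemma condExp_sum_mul [Fintype κ] {c g h : κ → Ω → ℝ}
    (hc : ∀ k, Measurable[𝓜] (c k)) (hcg : ∀ k, Integrable (fun ω => c k ω * g k ω) P)
    (hg : ∀ k, Integrable (g k) P) (hgh : ∀ k, P[g k | 𝓜] =ᵐ[P] h k) :
    P[fun ω => ∑ k, c k ω * g k ω | 𝓜] =ᵐ[P] fun ω => ∑ k, c k ω * h k ω := by
  have h1 : (fun ω => ∑ k, c k ω * g k ω) = ∑ k, c k * g k := by
    ext ω; simp
  have h2 : ∀ᵐ ω ∂P, ∀ k, P[c k * g k | 𝓜] ω = c k ω * h k ω := by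
    rw [ae_all_iff]
    intro k
    filter_upwards [condExp_mul_of_stronglyMeasurable_left (hc k).stronglyMeasurable (hcg k) (hg k),
      hgh k] with ω h3 h4
    rw [h3, Pi.mul_apply, h4]
  rw [h1]
  filter_upwards [condExp_finsetSum (s := Finset.univ) (fun k _ => hcg k) 𝓜, h2] with ω h3 h4
  rw [show (∑ k, c k * g k) = ∑ k, (fun ω => c k ω * g k ω) from rfl, h3, Finset.sum_apply]
  exact Finset.sum_congr rfl fun k _ => h4 k

/-- `X` is square integrable, has zero conditional mean and conditional covariance `S`. -/
structure CentredCond (𝓜 : MeasurableSpace Ω) {mΩ : MeasurableSpace Ω} (P : Measure Ω)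
    (X : Ω → ι → ℝ) (S : Ω → Matrix ι ι ℝ) : Prop where
  memLp : ∀ i, MemLp (fun ω => X ω i) 2 P
  mean : ∀ i, P[fun ω => X ω i | 𝓜] =ᵐ[P] 0
  cov : ∀ i j, P[fun ω => X ω i * X ω j | 𝓜] =ᵐ[P] fun ω => S ω i j

namespace CentredCond

variable [IsProbabilityMeasure P] {X : Ω → ι → ℝ} {S : Ω → Matrix ι ι ℝ} {Z : Ω → κ → ℝ}
  {T : Ω → Matrix κ κ ℝ}

lemma integrable (h : CentredCond 𝓜 P X S) (i : ι) : Integrable (fun ω => X ω i) P :=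
  (h.memLp i).integrable one_le_two

omit [IsProbabilityMeasure P] in
lemma integrable_mul (h : CentredCond 𝓜 P X S) (i j : ι) :
    Integrable (fun ω => X ω i * X ω j) P :=
  (h.memLp i).integrable_mul (h.memLp j)

/-- Linear images, where the matrix may depend on the conditioning information. -/
lemma mulVec [Fintype ι] (h : CentredCond 𝓜 P X S) (h𝓜 : 𝓜 ≤ mΩ) {F : Ω → Matrix κ ι ℝ}
    (hF : Measurable[𝓜] F) (hb : BddMat F) :
    CentredCond 𝓜 P (fun ω => F ω *ᵥ X ω) (fun ω => F ω * S ω * (F ω)ᵀ) := by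
  have hFm : ∀ i j, Measurable[𝓜] fun ω => F ω i j := (@measurable_matrix_iff Ω κ ι 𝓜 F).1 hF
  obtain ⟨c, hc⟩ := hb
  -- A bound on the entries is nonnegative only if there is an entry, hence the seemingly idle
  -- arguments.
  have hc0 : ∀ ω : Ω, ∀ i : κ, ∀ j : ι, 0 ≤ c := fun ω i j => (abs_nonneg _).trans (hc ω i j)
  refine ⟨memLp_mulVec (hF.mono h𝓜 le_rfl) ⟨c, hc⟩ h.memLp, fun i => ?_, fun i j => ?_⟩
  · have := condExp_sum_mul (P := P) (c := fun k ω => F ω i k) (fun k => hFm i k)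
      (fun k => (memLp_bdd_mul ((hFm i k).mono h𝓜 le_rfl) (fun ω => hc ω i k)
        (h.memLp k)).integrable one_le_two) h.integrable h.mean
    simpa [Matrix.mulVec, dotProduct, Pi.zero_def] using this
  · have h1 : (fun ω => (F ω *ᵥ X ω) i * (F ω *ᵥ X ω) j)
        = fun ω => ∑ ab : ι × ι, (F ω i ab.1 * F ω j ab.2) * (X ω ab.1 * X ω ab.2) := by
      ext ω
      simp only [Matrix.mulVec, dotProduct, Finset.sum_mul_sum, Fintype.sum_prod_type]
      exact Finset.sum_congr rfl fun a _ => Finset.sum_congr rfl fun b _ => by ring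
    have h2 : (fun ω => (F ω * S ω * (F ω)ᵀ) i j)
        = fun ω => ∑ ab : ι × ι, (F ω i ab.1 * F ω j ab.2) * S ω ab.1 ab.2 := by
      ext ω
      simp only [Matrix.mul_apply, Matrix.transpose_apply, Finset.sum_mul, Fintype.sum_prod_type]
      rw [Finset.sum_comm]
      exact Finset.sum_congr rfl fun a _ => Finset.sum_congr rfl fun b _ => by ring
    rw [h1, h2]
    have hm : ∀ ab : ι × ι, Measurable[𝓜] fun ω => F ω i ab.1 * F ω j ab.2 :=
      fun ab => Measurable.mul (hFm i ab.1) (hFm j ab.2)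
    refine condExp_sum_mul hm (fun ab => ?_) (fun ab => h.integrable_mul _ _) fun ab => h.cov _ _
    exact (h.integrable_mul ab.1 ab.2).bdd_mul (c := c * c)
      ((hm ab).mono h𝓜 le_rfl).aestronglyMeasurable (.of_forall fun ω => by
        rw [norm_mul]
        exact mul_le_mul (hc ω _ _) (hc ω _ _) (norm_nonneg _) (hc0 ω i ab.1))

omit [IsProbabilityMeasure P] in
lemma congr {X' : Ω → ι → ℝ} {S' : Ω → Matrix ι ι ℝ} (h : CentredCond 𝓜 P X S)
    (hX : ∀ ω, X ω = X' ω) (hS : ∀ ω, S ω = S' ω) : CentredCond 𝓜 P X' S' := by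
  rwa [← funext hX, ← funext hS]

omit [IsProbabilityMeasure P] in
/-- Two conditionally uncorrelated vectors, stacked. -/
lemma stack (hX : CentredCond 𝓜 P X S) (hZ : CentredCond 𝓜 P Z T)
    (hXZ : ∀ i j, P[fun ω => X ω i * Z ω j | 𝓜] =ᵐ[P] 0) :
    CentredCond 𝓜 P (fun ω => Sum.elim (X ω) (Z ω))
      (fun ω => Matrix.fromBlocks (S ω) 0 0 (T ω)) := by
  refine ⟨?_, ?_, ?_⟩
  · rintro (i | i)
    exacts [hX.memLp i, hZ.memLp i]
  · rintro (i | i)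
    exacts [hX.mean i, hZ.mean i]
  · rintro (i | i) (j | j)
    · exact hX.cov i j
    · exact hXZ i j
    · simp only [Sum.elim_inl, Sum.elim_inr, mul_comm (Z _ i)]
      exact hXZ j i
    · exact hZ.cov i j

/-- Conditional second moment of `m + X`, where `m` is known. -/
lemma condExp_quadratic [Fintype ι] (h : CentredCond 𝓜 P X S) (h𝓜 : 𝓜 ≤ mΩ)
    {a : Ω → ι → ℝ} (ha : Measurable[𝓜] a) (haL : ∀ i, MemLp (fun ω => a ω i) 2 P)
    (G : Matrix ι ι ℝ) :
    P[fun ω => (a ω + X ω) ⬝ᵥ (G *ᵥ (a ω + X ω)) | 𝓜]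
      =ᵐ[P] fun ω => a ω ⬝ᵥ (G *ᵥ a ω) + (G * S ω).trace := by
  have ham : ∀ i, Measurable[𝓜] fun ω => a ω i := fun i =>
    Measurable.comp (measurable_pi_apply i) ha
  -- The known part, the linear part with zero conditional mean, and the quadratic part. `G` is not
  -- assumed symmetric, so the linear part carries G + Gᵀ.
  set f₁ : Ω → ℝ := fun ω => a ω ⬝ᵥ (G *ᵥ a ω)
  set f₂ : Ω → ℝ := fun ω => ∑ ij : ι × ι, ((G ij.1 ij.2 + G ij.2 ij.1) * a ω ij.1) * X ω ij.2
  set f₃ : Ω → ℝ := fun ω => ∑ ij : ι × ι, G ij.1 ij.2 * (X ω ij.1 * X ω ij.2)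
  have hsum : (fun ω => (a ω + X ω) ⬝ᵥ (G *ᵥ (a ω + X ω))) = f₁ + (f₂ + f₃) := by
    ext ω
    have e : ∀ x y : ι → ℝ, x ⬝ᵥ (G *ᵥ y) = ∑ i, ∑ j, G i j * (x i * y j) := fun x y => by
      simp only [dotProduct, Matrix.mulVec, Finset.mul_sum]
      exact Finset.sum_congr rfl fun i _ => Finset.sum_congr rfl fun j _ => by ring
    rw [Matrix.mulVec_add, dotProduct_add, add_dotProduct, add_dotProduct]
    simp only [Pi.add_apply, f₁, f₂, f₃, e, Fintype.sum_prod_type, add_mul, Finset.sum_add_distrib]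
    have : ∑ i, ∑ j, G i j * (X ω i * a ω j) = ∑ i, ∑ j, G j i * a ω i * X ω j := by
      rw [Finset.sum_comm]
      exact Finset.sum_congr rfl fun i _ => Finset.sum_congr rfl fun j _ => by ring
    rw [this]
    simp only [mul_assoc]
    ring
  have i₁ : Integrable f₁ P := integrable_dotProduct haL (memLp_const_mulVec G haL)
  have j₂ : ∀ ij : ι × ι, Integrable
      (fun ω => ((G ij.1 ij.2 + G ij.2 ij.1) * a ω ij.1) * X ω ij.2) P := fun ij =>
    ((haL ij.1).const_mul _).integrable_mul (h.memLp ij.2)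
  have i₂ : Integrable f₂ P := integrable_finsetSum _ fun ij _ => j₂ ij
  have j₃ : ∀ ij : ι × ι, Integrable (fun ω => G ij.1 ij.2 * (X ω ij.1 * X ω ij.2)) P :=
    fun ij => (h.integrable_mul _ _).const_mul _
  have i₃ : Integrable f₃ P := integrable_finsetSum _ fun ij _ => j₃ ij
  have m₁ : Measurable[𝓜] f₁ :=
    @measurable_dotProduct Ω ι 𝓜 _ _ _ ha (@measurable_mulVec Ω ι ι 𝓜 _ _ _ measurable_const ha)
  have c₁ : P[f₁ | 𝓜] = f₁ := condExp_of_stronglyMeasurable h𝓜 m₁.stronglyMeasurable i₁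
  have c₂ : P[f₂ | 𝓜] =ᵐ[P] fun ω => ∑ ij : ι × ι, ((G ij.1 ij.2 + G ij.2 ij.1) * a ω ij.1) * 0 :=
    condExp_sum_mul (h := fun _ _ => 0) (fun ij => (ham ij.1).const_mul _) j₂
      (fun ij => h.integrable _) fun ij => h.mean _
  have c₃ : P[f₃ | 𝓜] =ᵐ[P] fun ω => ∑ ij : ι × ι, G ij.1 ij.2 * S ω ij.1 ij.2 :=
    condExp_sum_mul (fun ij => measurable_const) j₃ (fun ij => h.integrable_mul _ _)
      fun ij => h.cov _ _
  -- The quadratic part yields Σ G_ij S_ij while the trace is Σ G_ij S_ji; a conditional second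
  -- moment is almost surely symmetric.
  have hS : ∀ᵐ ω ∂P, ∀ i j, S ω i j = S ω j i := by
    rw [ae_all_iff]; intro i
    rw [ae_all_iff]; intro j
    filter_upwards [h.cov i j, h.cov j i] with ω h1 h2
    rw [← h1, ← h2]
    simp only [mul_comm]
  rw [hsum]
  filter_upwards [condExp_add i₁ (i₂.add i₃) 𝓜, condExp_add i₂ i₃ 𝓜, c₂, c₃, hS]
    with ω h1 h2 h3 h4 h5
  rw [h1, Pi.add_apply, h2, Pi.add_apply, h3, h4, c₁]
  simp only [mul_zero, Finset.sum_const_zero, zero_add, Matrix.trace, Matrix.diag, Matrix.mul_apply,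
    Fintype.sum_prod_type, f₁]
  congr 1
  exact Finset.sum_congr rfl fun i _ => Finset.sum_congr rfl fun j _ => by rw [h5]

end CentredCond

/-- `Z` is a centred square integrable random vector with covariance `T`. -/
structure IsCentred (P : Measure Ω) (Z : Ω → κ → ℝ) (T : Matrix κ κ ℝ) : Prop where
  measurable : Measurable Z
  memLp : ∀ i, MemLp (fun ω => Z ω i) 2 P
  mean : ∀ i, ∫ ω, Z ω i ∂P = 0
  cov : ∀ i j, ∫ ω, Z ω i * Z ω j ∂P = T i j

namespace IsCentred

variable [IsProbabilityMeasure P] {Z : Ω → κ → ℝ} {T : Matrix κ κ ℝ}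

lemma condExp_eq_zero (hZ : IsCentred P Z T) (h𝓜 : 𝓜 ≤ mΩ)
    (hind : Indep (MeasurableSpace.comap Z inferInstance) 𝓜 P) (i : κ) :
    P[fun ω => Z ω i | 𝓜] =ᵐ[P] 0 := by
  have hm : Measurable[MeasurableSpace.comap Z inferInstance] fun ω => Z ω i :=
    (measurable_pi_apply i).comp (comap_measurable Z)
  have := condExp_indep_eq hZ.measurable.comap_le h𝓜 hm.stronglyMeasurable hind
  rw [hZ.mean i] at this
  exact this

lemma centredCond (hZ : IsCentred P Z T) (h𝓜 : 𝓜 ≤ mΩ)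
    (hind : Indep (MeasurableSpace.comap Z inferInstance) 𝓜 P) :
    CentredCond 𝓜 P Z fun _ => T := by
  refine ⟨hZ.memLp, hZ.condExp_eq_zero h𝓜 hind, fun i j => ?_⟩
  have hm : ∀ i, Measurable[MeasurableSpace.comap Z inferInstance] fun ω => Z ω i :=
    fun i => (measurable_pi_apply i).comp (comap_measurable Z)
  have := condExp_indep_eq hZ.measurable.comap_le h𝓜
    (Measurable.mul (hm i) (hm j)).stronglyMeasurable hind
  rw [← hZ.cov i j]
  exact this

/-- Condition first on the larger `𝓖`, for which `f` is known and `Z` is fresh, then apply the tower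
property. -/
lemma condExp_mul_eq_zero (hZ : IsCentred P Z T) {𝓖 : MeasurableSpace Ω} (h𝓜 : 𝓜 ≤ 𝓖)
    (h𝓖 : 𝓖 ≤ mΩ) (hind : Indep (MeasurableSpace.comap Z inferInstance) 𝓖 P)
    {f : Ω → ℝ} (hf : Measurable[𝓖] f) (hfL : MemLp f 2 P) (j : κ) :
    P[fun ω => f ω * Z ω j | 𝓜] =ᵐ[P] 0 := by
  have h1 : P[fun ω => f ω * Z ω j | 𝓖] =ᵐ[P] 0 := by
    filter_upwards [condExp_mul_of_stronglyMeasurable_left hf.stronglyMeasurable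
      (hfL.integrable_mul (hZ.memLp j)) ((hZ.memLp j).integrable one_le_two),
      hZ.condExp_eq_zero h𝓖 hind j] with ω h2 h3
    have h2' : P[fun ω => f ω * Z ω j | 𝓖] ω = _ := h2
    rw [h2', Pi.mul_apply, h3]
    simp
  refine (condExp_condExp_of_le h𝓜 h𝓖).symm.trans ((condExp_congr_ae h1).trans ?_)
  rw [condExp_zero]

end IsCentred

/-- One step `F X - K v + w` of a linear recursion with fresh noises `v`, `w`. -/
lemma CentredCond.step [IsProbabilityMeasure P] [Fintype ι] [DecidableEq ι] [Fintype κ]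
    {X : Ω → ι → ℝ} {S : Ω → Matrix ι ι ℝ} {v : Ω → κ → ℝ} {V : Matrix κ κ ℝ}
    {w : Ω → ι → ℝ} {W : Matrix ι ι ℝ}
    {𝓖 : MeasurableSpace Ω} (hX : CentredCond 𝓜 P X S) (h𝓜 : 𝓜 ≤ 𝓖) (h𝓖 : 𝓖 ≤ mΩ)
    (hXm : Measurable[𝓖] X) (hv : IsCentred P v V) (hw : IsCentred P w W)
    (hvi : Indep (MeasurableSpace.comap v inferInstance) 𝓖 P)
    (hwi : Indep (MeasurableSpace.comap w inferInstance)
      (𝓖 ⊔ MeasurableSpace.comap v inferInstance) P)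
    {F : Ω → Matrix ι ι ℝ} {K : Ω → Matrix ι κ ℝ} (hF : Measurable[𝓜] F) (hK : Measurable[𝓜] K)
    (hFb : BddMat F) (hKb : BddMat K) :
    CentredCond 𝓜 P (fun ω => F ω *ᵥ X ω + w ω - K ω *ᵥ v ω)
      (fun ω => F ω * S ω * (F ω)ᵀ + W + K ω * V * (K ω)ᵀ) := by
  have hXi : ∀ i, Measurable[𝓖] fun ω => X ω i := fun i =>
    Measurable.comp (measurable_pi_apply i) hXm
  have hle : 𝓖 ⊔ MeasurableSpace.comap v inferInstance ≤ mΩ := sup_le h𝓖 hv.measurable.comap_le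
  have h1 := hX.stack (hv.centredCond (h𝓜.trans h𝓖) (indep_of_indep_of_le_right hvi h𝓜))
    fun i j => hv.condExp_mul_eq_zero h𝓜 h𝓖 hvi (hXi i) (hX.memLp i) j
  have h2 := h1.stack (hw.centredCond (h𝓜.trans h𝓖)
      (indep_of_indep_of_le_right hwi (h𝓜.trans le_sup_left))) fun i j => by
    refine hw.condExp_mul_eq_zero (h𝓜.trans le_sup_left) hle hwi ?_ (h1.memLp i) j
    rcases i with i | i
    · exact (hXi i).mono le_sup_left le_rfl
    · exact (Measurable.comp (measurable_pi_apply i) (comap_measurable v)).mono le_sup_right le_rfl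
  have hFm : ∀ i j, Measurable[𝓜] fun ω => F ω i j := (@measurable_matrix_iff Ω ι ι 𝓜 F).1 hF
  have hKm : ∀ i j, Measurable[𝓜] fun ω => K ω i j := (@measurable_matrix_iff Ω ι κ 𝓜 K).1 hK
  -- The new vector is the image of the stacked ((X, v), w), whose blocks are conditionally
  -- uncorrelated, under the known block row (F, -K, 1).
  have h3 := h2.mulVec (h𝓜.trans h𝓖)
    (F := fun ω => Matrix.fromCols (Matrix.fromCols (F ω) (-(K ω))) (1 : Matrix ι ι ℝ))
    ((@measurable_matrix_iff Ω _ _ 𝓜 _).2 (by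
      rintro i ((j | j) | j)
      · exact hFm i j
      · exact Measurable.neg (hKm i j)
      · exact measurable_const))
    (by
      obtain ⟨c, hc⟩ := hFb
      obtain ⟨c', hc'⟩ := hKb
      obtain ⟨c'', hc''⟩ := bddMat_const (Ω := Ω) (1 : Matrix ι ι ℝ)
      refine ⟨max c (max c' c''), ?_⟩
      rintro ω i ((j | j) | j)
      · exact (hc ω i j).trans (le_max_left _ _)
      · simp only [Matrix.fromCols_apply_inl, Matrix.fromCols_apply_inr, Matrix.neg_apply, abs_neg]
        exact (hc' ω i j).trans ((le_max_left _ _).trans (le_max_right _ _))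
      · exact (hc'' ω i j).trans ((le_max_right _ _).trans (le_max_right _ _)))
  refine h3.congr (fun ω => ?_) fun ω => ?_
  · rw [Matrix.fromCols_mulVec_sumElim, Matrix.fromCols_mulVec_sumElim, Matrix.one_mulVec,
      Matrix.neg_mulVec]
    abel
  · simp [Matrix.transpose_fromCols, Matrix.fromCols_mul_fromBlocks,
      Matrix.fromCols_mul_fromRows]
    abel

end CondMoments

/-! ### Independence -/

section Independence

variable {Ω : Type*} {mΩ : MeasurableSpace Ω} {P : Measure Ω} [IsProbabilityMeasure P]

/-- On the π-system of intersections s ∩ t, P(s ∩ t ∩ u) = P(t) P(s ∩ u) = P(t) P(s) P(u). This is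
how further independent information is adjoined to one side of an independent pair. -/
lemma indep_sup_of_indep {m₁ m₂ m₃ : MeasurableSpace Ω} (h₁ : m₁ ≤ mΩ) (h₂ : m₂ ≤ mΩ)
    (h₃ : m₃ ≤ mΩ) (h₁₂ : Indep m₁ m₂ P) (h : Indep m₃ (m₁ ⊔ m₂) P) : Indep (m₁ ⊔ m₃) m₂ P := by
  set p : Set (Set Ω) := Set.image2 (· ∩ ·) {s | MeasurableSet[m₁] s} {s | MeasurableSet[m₃] s}
  have hgen : m₁ ⊔ m₃ = MeasurableSpace.generateFrom p := by
    apply le_antisymm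
    · refine sup_le (fun s hs => ?_) fun s hs => ?_
      · exact MeasurableSpace.measurableSet_generateFrom
          ⟨s, hs, Set.univ, MeasurableSet.univ, Set.inter_univ s⟩
      · exact MeasurableSpace.measurableSet_generateFrom
          ⟨Set.univ, MeasurableSet.univ, s, hs, Set.univ_inter s⟩
    · refine MeasurableSpace.generateFrom_le ?_
      rintro _ ⟨s, hs, t, ht, rfl⟩
      exact MeasurableSet.inter ((le_sup_left : m₁ ≤ m₁ ⊔ m₃) s hs)
        ((le_sup_right : m₃ ≤ m₁ ⊔ m₃) t ht)
  have hpi : IsPiSystem p := by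
    rintro _ ⟨s, hs, t, ht, rfl⟩ _ ⟨s', hs', t', ht', rfl⟩ -
    exact ⟨s ∩ s', MeasurableSet.inter hs hs', t ∩ t', MeasurableSet.inter ht ht',
      Set.inter_inter_inter_comm _ _ _ _⟩
  refine IndepSets.indep (sup_le h₁ h₃) h₂ hpi (@MeasurableSpace.isPiSystem_measurableSet Ω m₂)
    hgen (@MeasurableSpace.generateFrom_measurableSet Ω m₂).symm ?_
  rw [IndepSets_iff]
  rintro _ u ⟨s, hs, t, ht, rfl⟩ hu
  rw [Indep_iff] at h h₁₂
  have hsu : MeasurableSet[m₁ ⊔ m₂] (s ∩ u) :=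
    MeasurableSet.inter ((le_sup_left : m₁ ≤ m₁ ⊔ m₂) s hs) ((le_sup_right : m₂ ≤ m₁ ⊔ m₂) u hu)
  have e1 : s ∩ t ∩ u = t ∩ (s ∩ u) := by
    rw [Set.inter_comm s t, Set.inter_assoc]
  have e2 : P (s ∩ t) = P t * P s := by
    rw [Set.inter_comm, h _ _ ht ((le_sup_left : m₁ ≤ m₁ ⊔ m₂) s hs)]
  change P (s ∩ t ∩ u) = P (s ∩ t) * P u
  rw [e1, h _ _ ht hsu, h₁₂ _ _ hs hu, e2, mul_assoc]

lemma comap_prodMk_eq {β γ : Type*} [MeasurableSpace β] [MeasurableSpace γ] (f : Ω → β)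
    (g : Ω → γ) : MeasurableSpace.comap (fun ω => (f ω, g ω)) inferInstance
      = MeasurableSpace.comap f inferInstance ⊔ MeasurableSpace.comap g inferInstance :=
  MeasurableSpace.comap_prodMk f g

end Independence

/-! ### Moments of Gaussian noise. -/

section Noise

variable {Ω : Type*} {mΩ : MeasurableSpace Ω} {P : Measure Ω} {ι : Type*} [Fintype ι]
  [DecidableEq ι]

lemma hasGaussianLaw_of_hasLaw {z : Ω → ι → ℝ} {μ : ι → ℝ} {T : Matrix ι ι ℝ}
    (h : HasLaw (fun ω => WithLp.toLp 2 (z ω)) (multivariateGaussian (WithLp.toLp 2 μ) T) P) :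
    HasGaussianLaw z P :=
  h.hasGaussianLaw.map_equiv (PiLp.continuousLinearEquiv 2 ℝ fun _ : ι => ℝ)

/-- Semidefiniteness of `T` serves only to identify the covariance of the Gaussian law; the mean
needs no condition. -/
lemma isCentred_of_hasLaw {z : Ω → ι → ℝ} {μ : ι → ℝ} {T : Matrix ι ι ℝ} (hz : Measurable z)
    (hT : T.PosSemidef)
    (h : HasLaw (fun ω => WithLp.toLp 2 (z ω)) (multivariateGaussian (WithLp.toLp 2 μ) T) P) :
    IsCentred P (fun ω => z ω - μ) T := by
  have hG := hasGaussianLaw_of_hasLaw h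
  have := hG.isProbabilityMeasure
  have hL : ∀ i, MemLp (fun ω => z ω i) 2 P := fun i => MemLp.eval hG.memLp_two i
  have hmean : ∀ i, ∫ ω, z ω i ∂P = μ i := by
    intro i
    have h1 := h.integral_comp (f := fun x : EuclideanSpace ℝ ι => x i)
      (by fun_prop)
    have h2 : ∫ x : EuclideanSpace ℝ ι, x i ∂(multivariateGaussian (WithLp.toLp 2 μ) T) = μ i := by
      have h3 := integral_id_multivariateGaussian (μ := WithLp.toLp 2 μ) (S := T)
      have h4 := (EuclideanSpace.proj (𝕜 := ℝ) i).integral_comp_comm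
        (IsGaussian.integrable_id (μ := multivariateGaussian (WithLp.toLp 2 μ) T))
      simp only [id] at h4
      rw [h3] at h4
      simpa using h4
    rw [← h2, ← h1]
    rfl
  refine ⟨hz.sub measurable_const, fun i => (hL i).sub (memLp_const _), fun i => ?_, fun i j => ?_⟩
  · simp only [Pi.sub_apply]
    rw [integral_sub ((hL i).integrable one_le_two) (integrable_const _), hmean]
    simp
  · rw [← covariance_eval_multivariateGaussian (μ := WithLp.toLp 2 μ) hT i j]
    rw [← h.map_eq, covariance_map (by fun_prop) (by fun_prop) h.aemeasurable]
    simp only [covariance, Function.comp_def, hmean, Pi.sub_apply]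

end Noise

/-! ### The filtration of the noises and its independence properties. -/

namespace LQGSystem

variable {n m p : ℕ} {sys : LQGSystem n m p} {Ω : Type*} [mΩ : MeasurableSpace Ω] {P : Measure Ω}
  {x0 : Ω → Fin n → ℝ} {w : ℕ → Ω → Fin n → ℝ} {v : ℕ → Ω → Fin p → ℝ}

/-- The σ-algebra generated by the initial state and the noises before time `k`. -/
@[reducible]
def pastSigma (x0 : Ω → Fin n → ℝ) (w : ℕ → Ω → Fin n → ℝ) (v : ℕ → Ω → Fin p → ℝ) :
    ℕ → MeasurableSpace Ω
  | 0 => MeasurableSpace.comap x0 inferInstance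
  | k + 1 => pastSigma x0 w v k ⊔ MeasurableSpace.comap (v k) inferInstance
      ⊔ MeasurableSpace.comap (w k) inferInstance

omit mΩ in
lemma pastSigma_mono : Monotone (pastSigma x0 w v) :=
  monotone_nat_of_le_succ fun _ => le_sup_left.trans le_sup_left

omit mΩ in
lemma measurable_x0_past (k : ℕ) : Measurable[pastSigma x0 w v k] x0 :=
  (comap_measurable x0).mono (pastSigma_mono (Nat.zero_le k)) le_rfl

omit mΩ in
lemma measurable_w_past {t k : ℕ} (h : t < k) : Measurable[pastSigma x0 w v k] (w t) :=
  (comap_measurable (w t)).mono (le_sup_right.trans (pastSigma_mono h)) le_rfl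

omit mΩ in
lemma measurable_v_past {t k : ℕ} (h : t < k) : Measurable[pastSigma x0 w v k] (v t) :=
  (comap_measurable (v t)).mono ((le_sup_right.trans le_sup_left).trans (pastSigma_mono h)) le_rfl

namespace IsNoise

lemma pastSigma_le (h : sys.IsNoise P x0 w v) (k : ℕ) : pastSigma x0 w v k ≤ mΩ := by
  induction k with
  | zero => exact h.measurable_x0.comap_le
  | succ k ih => exact sup_le (sup_le ih (h.measurable_v k).comap_le) (h.measurable_w k).comap_le

/-- The noise at time k is independent of the finite block of earlier noises, and x0 of the block
and the noise at time k together; x0 is then adjoined to the block, and the result contains the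
past. -/
lemma indep_past [IsProbabilityMeasure P] (h : sys.IsNoise P x0 w v) (k : ℕ) :
    Indep (pastSigma x0 w v k)
      (MeasurableSpace.comap (fun ω => (w k ω, v k ω)) inferInstance) P := by
  set r : Ω → (Finset.range k) → (Fin n → ℝ) × (Fin p → ℝ) := fun ω t => (w t ω, v t ω)
  set z : Ω → (Fin n → ℝ) × (Fin p → ℝ) := fun ω => (w k ω, v k ω)
  have hm : ∀ t, Measurable fun ω => (w t ω, v t ω) := fun t =>
    (h.measurable_w t).prodMk (h.measurable_v t)
  have hr : Measurable r := measurable_pi_lambda _ fun t => hm t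
  have h1 : IndepFun r z P := by
    have := h.indep_time.indepFun_finset (Finset.range k) {k} (by simp) hm
    exact this.comp measurable_id (measurable_pi_apply (⟨k, by simp⟩ : ({k} : Finset ℕ)))
  have h2 : IndepFun x0 (fun ω => (r ω, z ω)) P := by
    have hφ : Measurable fun f : ℕ → (Fin n → ℝ) × (Fin p → ℝ) =>
        ((fun t : Finset.range k => f t), f k) :=
      (measurable_pi_lambda _ fun t => measurable_pi_apply _).prodMk (measurable_pi_apply k)
    exact h.indep_x0.comp measurable_id hφ
  rw [IndepFun_iff_Indep] at h1 h2
  rw [show MeasurableSpace.comap (fun ω => (r ω, z ω)) Prod.instMeasurableSpace = _ from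
    comap_prodMk_eq r z] at h2
  have h3 := indep_sup_of_indep hr.comap_le (hm k).comap_le h.measurable_x0.comap_le h1 h2
  refine indep_of_indep_of_le_left h3 ?_
  suffices hs : ∀ j ≤ k, pastSigma x0 w v j ≤ MeasurableSpace.comap r inferInstance
      ⊔ MeasurableSpace.comap x0 inferInstance from hs k le_rfl
  intro j
  induction j with
  | zero => exact fun _ => le_sup_right
  | succ j ih =>
    intro hj
    have hrj : Measurable[MeasurableSpace.comap r inferInstance] fun ω => (w j ω, v j ω) :=
      (measurable_pi_apply (⟨j, by simp; omega⟩ : Finset.range k)).comp (comap_measurable r)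
    refine sup_le (sup_le (ih (by omega)) ?_) ?_
    · exact (Measurable.comap_le (measurable_snd.comp hrj)).trans le_sup_left
    · exact (Measurable.comap_le (measurable_fst.comp hrj)).trans le_sup_left

lemma indep_v_past [IsProbabilityMeasure P] (h : sys.IsNoise P x0 w v) (k : ℕ) :
    Indep (MeasurableSpace.comap (v k) inferInstance) (pastSigma x0 w v k) P :=
  indep_of_indep_of_le_left (h.indep_past k).symm
    (Measurable.comap_le (measurable_snd.comp (comap_measurable fun ω => (w k ω, v k ω))))

/-- Adjoining v_k to the past uses independence of w_k and v_k at equal times. It is needed since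
the decision and the filter at time k already see v_k, through y_k. -/
lemma indep_w_past [IsProbabilityMeasure P] (h : sys.IsNoise P x0 w v) (k : ℕ) :
    Indep (MeasurableSpace.comap (w k) inferInstance)
      (pastSigma x0 w v k ⊔ MeasurableSpace.comap (v k) inferInstance) P := by
  have h1 := (IndepFun_iff_Indep _ _ _).1 (h.indep_wv k)
  have h2 := h.indep_past k
  rw [comap_prodMk_eq, sup_comm] at h2
  have := indep_sup_of_indep (h.measurable_v k).comap_le (h.measurable_w k).comap_le
    (h.pastSigma_le k) h1.symm h2
  rw [sup_comm]
  exact this.symm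

lemma isCentred_x0 (h : sys.IsNoise P x0 w v) (hsys : sys.WellPosed) :
    IsCentred P (fun ω => x0 ω - sys.m₀) sys.M₀ :=
  isCentred_of_hasLaw h.measurable_x0 hsys.posDef_M₀.posSemidef h.law_x0

lemma isCentred_w (h : sys.IsNoise P x0 w v) (hsys : sys.WellPosed) (k : ℕ) :
    IsCentred P (w k) (sys.W k) := by
  simpa using isCentred_of_hasLaw (μ := 0) (h.measurable_w k) (hsys.posDef_W k).posSemidef
    (h.law_w k)

lemma isCentred_v (h : sys.IsNoise P x0 w v) (hsys : sys.WellPosed) (k : ℕ) :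
    IsCentred P (v k) (sys.V k) := by
  simpa using isCentred_of_hasLaw (μ := 0) (h.measurable_v k) (hsys.posDef_V k).posSemidef
    (h.law_v k)

end IsNoise

end LQGSystem

end EventTriggered

namespace EventTriggered

/-! ### Unconditional moments of linear images and stacked vectors. -/

section Linear

variable {Ω : Type*} {mΩ : MeasurableSpace Ω} {P : Measure Ω} [IsProbabilityMeasure P]
  {ι κ l : Type*}

lemma ae_const_eq {a b : ℝ} (h : (fun _ : Ω => a) =ᵐ[P] fun _ => b) : a = b :=
  h.exists.choose_spec

/-- Conditioning on the trivial σ-algebra is integration, so unconditional moments are obtained from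
the conditional calculus. -/
lemma CentredCond.isCentred {Z : Ω → ι → ℝ} {T : Matrix ι ι ℝ} (hZ : Measurable Z)
    (h : CentredCond ⊥ P Z fun _ => T) : IsCentred P Z T := by
  refine ⟨hZ, h.memLp, fun i => ?_, fun i j => ?_⟩
  · have := h.mean i
    rw [condExp_bot] at this
    exact ae_const_eq this
  · have := h.cov i j
    rw [condExp_bot] at this
    exact ae_const_eq this

namespace IsCentred

variable {Z : Ω → ι → ℝ} {T : Matrix ι ι ℝ} {Z' : Ω → κ → ℝ} {T' : Matrix κ κ ℝ}

lemma mulVec [Fintype ι] [Finite l] (h : IsCentred P Z T) (F : Matrix l ι ℝ) :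
    IsCentred P (fun ω => F *ᵥ Z ω) (F * T * Fᵀ) :=
  ((h.centredCond bot_le (indep_bot_right _)).mulVec bot_le (F := fun _ => F) measurable_const
    (bddMat_const F)).isCentred (measurable_mulVec measurable_const h.measurable)

omit [IsProbabilityMeasure P] in
lemma stack (h : IsCentred P Z T) (h' : IsCentred P Z' T') (hi : IndepFun Z Z' P) :
    IsCentred P (fun ω => Sum.elim (Z ω) (Z' ω)) (Matrix.fromBlocks T 0 0 T') := by
  have hcross : ∀ i j, ∫ ω, Z ω i * Z' ω j ∂P = 0 := fun i j => by
    have := (hi.comp (measurable_pi_apply i) (measurable_pi_apply j)).integral_mul_eq_mul_integral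
      (h.memLp i).1 (h'.memLp j).1
    have e : ∫ ω, Z ω i * Z' ω j ∂P = (∫ ω, Z ω i ∂P) * ∫ ω, Z' ω j ∂P := this
    rw [e, h.mean i, zero_mul]
  refine ⟨measurable_pi_lambda _ ?_, ?_, ?_, ?_⟩
  · rintro (i | i)
    exacts [(measurable_pi_apply i).comp h.measurable, (measurable_pi_apply i).comp h'.measurable]
  · rintro (i | i)
    exacts [h.memLp i, h'.memLp i]
  · rintro (i | i)
    exacts [h.mean i, h'.mean i]
  · rintro (i | i) (j | j)
    · exact h.cov i j
    · exact hcross i j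
    · simp only [Sum.elim_inl, Sum.elim_inr, mul_comm (Z' _ i)]
      exact hcross j i
    · exact h'.cov i j

end IsCentred

end Linear

namespace LQGSystem

variable {n m p : ℕ} (sys : LQGSystem n m p)

/-! ### The Kalman filter of the event trigger -/

/-- Prediction error of the filter at the event trigger. -/
noncomputable def priorErr (x0 : Fin n → ℝ) (w : ℕ → Fin n → ℝ) (v : ℕ → Fin p → ℝ) : ℕ → Fin n → ℝ
  | 0 => x0 - sys.m₀
  | k + 1 =>
    sys.A k *ᵥ (priorErr x0 w v k - sys.H k *ᵥ (sys.C k *ᵥ priorErr x0 w v k + v k)) + w k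

/-- Estimation error of the filter at the event trigger. -/
noncomputable def filterErr (x0 : Fin n → ℝ) (w : ℕ → Fin n → ℝ) (v : ℕ → Fin p → ℝ) (k : ℕ) :
    Fin n → ℝ :=
  sys.priorErr x0 w v k - sys.H k *ᵥ (sys.C k *ᵥ sys.priorErr x0 w v k + v k)

/-- Covariance of the prediction error. -/
noncomputable def priorCov : ℕ → Matrix (Fin n) (Fin n) ℝ
  | 0 => sys.M₀
  | k + 1 => sys.A k * sys.Sig k * (sys.A k)ᵀ + sys.W k

/-- Inputs cancel and the filter always receives y, so neither policy nor control affects the filter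
error: it is a fixed linear function of the noises and of x0 - m₀. -/
lemma x_sub_xchk (π : Policy n p) (x0 : Fin n → ℝ) (w : ℕ → Fin n → ℝ) (v : ℕ → Fin p → ℝ)
    (k : ℕ) : (sys.loop π x0 w v k).x - (sys.loop π x0 w v k).info.xchk
      = sys.filterErr x0 w v k := by
  induction k with
  | zero =>
    simp only [loop, filterErr, priorErr, Matrix.mulVec_sub, Matrix.mulVec_add]
    abel
  | succ k ih =>
    rw [filterErr, priorErr, ← filterErr, ← ih]
    simp only [loop, Matrix.mulVec_sub, Matrix.mulVec_add]
    abel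

lemma Sig_eq (k : ℕ) :
    sys.Sig k = ((sys.priorCov k)⁻¹ + (sys.C k)ᵀ * (sys.V k)⁻¹ * sys.C k)⁻¹ := by
  cases k <;> rfl

variable {sys}

lemma posDef_Sig_of_priorCov (hsys : sys.WellPosed) {k : ℕ} (h : (sys.priorCov k).PosDef) :
    (sys.Sig k).PosDef := by
  rw [Sig_eq]
  have h1 := (hsys.posDef_V k).inv.posSemidef.conjTranspose_mul_mul_same (sys.C k)
  rw [Matrix.conjTranspose_eq_transpose_of_trivial] at h1
  exact (h.inv.add_posSemidef h1).inv

lemma posDef_priorCov (hsys : sys.WellPosed) (k : ℕ) : (sys.priorCov k).PosDef := by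
  induction k with
  | zero => exact hsys.posDef_M₀
  | succ k ih =>
    have h1 := (posDef_Sig_of_priorCov hsys ih).posSemidef.mul_mul_conjTranspose_same (sys.A k)
    rw [Matrix.conjTranspose_eq_transpose_of_trivial] at h1
    exact Matrix.PosDef.posSemidef_add h1 (hsys.posDef_W k)

/-- Multiplying the information form Σ⁻¹ = M⁻¹ + CᵀV⁻¹C by Σ from the left gives ΣM⁻¹ + HC = 1,
where M is the prior covariance. -/
lemma one_sub_H_mul_priorCov (hsys : sys.WellPosed) (k : ℕ) :
    (1 - sys.H k * sys.C k) * sys.priorCov k = sys.Sig k := by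
  have hP := (posDef_priorCov hsys k).isUnit
  have hS := (posDef_Sig_of_priorCov hsys (posDef_priorCov hsys k)).isUnit
  rw [Matrix.isUnit_iff_isUnit_det] at hP hS
  have hinv : (sys.Sig k)⁻¹ = (sys.priorCov k)⁻¹ + (sys.C k)ᵀ * (sys.V k)⁻¹ * sys.C k := by
    rw [Sig_eq]
    refine Matrix.nonsing_inv_nonsing_inv _ ?_
    rw [Sig_eq] at hS
    exact Matrix.isUnit_nonsing_inv_det_iff.1 hS
  have h1 : sys.Sig k * (sys.priorCov k)⁻¹ + sys.H k * sys.C k = 1 := by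
    rw [← Matrix.mul_nonsing_inv _ hS, hinv]
    simp only [H, Matrix.mul_add, Matrix.mul_assoc]
  rw [← h1, add_sub_cancel_right, Matrix.nonsing_inv_mul_cancel_right _ _ hP]

/-- Orthogonality: the error (1 - HC)η - Hv and the innovation Cη + v have zero covariance. This is
the property that defines the Kalman gain. -/
lemma cross_cov_eq_zero (hsys : sys.WellPosed) (k : ℕ) :
    (1 - sys.H k * sys.C k) * sys.priorCov k * (sys.C k)ᵀ = sys.H k * sys.V k := by
  have hV := (hsys.posDef_V k).isUnit
  rw [Matrix.isUnit_iff_isUnit_det] at hV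
  rw [one_sub_H_mul_priorCov hsys, H, Matrix.nonsing_inv_mul_cancel_right _ _ hV]

lemma joseph_eq (hsys : sys.WellPosed) (k : ℕ) :
    (1 - sys.H k * sys.C k) * sys.priorCov k * (1 - sys.H k * sys.C k)ᵀ
      + sys.H k * sys.V k * (sys.H k)ᵀ = sys.Sig k := by
  rw [Matrix.transpose_sub, Matrix.transpose_one, Matrix.mul_sub, Matrix.mul_one,
    Matrix.transpose_mul, ← Matrix.mul_assoc _ (sys.C k)ᵀ, cross_cov_eq_zero hsys,
    one_sub_H_mul_priorCov hsys]
  abel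

variable {Ω : Type*} [mΩ : MeasurableSpace Ω] {P : Measure Ω}
  {x0 : Ω → Fin n → ℝ} {w : ℕ → Ω → Fin n → ℝ} {v : ℕ → Ω → Fin p → ℝ} {π : Policy n p}

/-- The σ-algebra generated by the outputs before time `k`. -/
@[reducible]
noncomputable def outputsBefore (sys : LQGSystem n m p) (π : Policy n p) (x0 : Ω → Fin n → ℝ)
    (w : ℕ → Ω → Fin n → ℝ) (v : ℕ → Ω → Fin p → ℝ) : ℕ → MeasurableSpace Ω
  | 0 => ⊥
  | k + 1 => outputsBefore sys π x0 w v k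
      ⊔ MeasurableSpace.comap (fun ω => (sys.run π x0 w v k ω).info.y) inferInstance

omit mΩ in
lemma outputsBefore_mono : Monotone (sys.outputsBefore π x0 w v) :=
  monotone_nat_of_le_succ fun _ => le_sup_left

omit mΩ in
lemma measurable_y_outputsBefore {t k : ℕ} (h : t < k) :
    Measurable[sys.outputsBefore π x0 w v k] fun ω => (sys.run π x0 w v t ω).info.y :=
  (comap_measurable fun ω => (sys.run π x0 w v t ω).info.y).mono
    (le_sup_right.trans (outputsBefore_mono h)) le_rfl

omit mΩ in
-- `outputsBefore` grows by one supremum per step, which suits induction; independence from it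
-- descends to `outputSigma` along this inclusion.
lemma outputSigma_le_outputsBefore (k : ℕ) :
    sys.outputSigma π x0 w v k ≤ sys.outputsBefore π x0 w v (k + 1) :=
  Measurable.comap_le (@measurable_pi_lambda Ω _ _ (sys.outputsBefore π x0 w v (k + 1)) _ _
    fun t => measurable_y_outputsBefore t.2)

omit mΩ in
lemma measurable_info_outputSigma (hπ : ∀ k, Measurable (π k)) (k : ℕ) :
    Measurable[sys.outputSigma π x0 w v k] fun ω => (sys.run π x0 w v k ω).info := by
  refine @measurable_info_of_outputs n m p sys Ω (sys.outputSigma π x0 w v k) π x0 w v hπ k ?_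
  intro t ht
  exact (measurable_pi_apply (⟨t, Nat.lt_succ_of_le ht⟩ : Fin (k + 1))).comp
    (comap_measurable fun ω (t : Fin (k + 1)) => (sys.run π x0 w v t ω).info.y)

omit mΩ in
lemma measurable_priorErr {𝓜 : MeasurableSpace Ω} (k : ℕ) (hx0 : Measurable[𝓜] x0)
    (hw : ∀ t < k, Measurable[𝓜] (w t)) (hv : ∀ t < k, Measurable[𝓜] (v t)) :
    Measurable[𝓜] fun ω => sys.priorErr (x0 ω) (fun t => w t ω) (fun t => v t ω) k := by
  induction k with
  | zero => exact Measurable.sub hx0 measurable_const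
  | succ k ih =>
    have ih := ih (fun t ht => hw t (by omega)) fun t ht => hv t (by omega)
    exact Measurable.add (@measurable_mulVec Ω _ _ 𝓜 _ _ _ measurable_const
      (Measurable.sub ih (@measurable_mulVec Ω _ _ 𝓜 _ _ _ measurable_const
        (Measurable.add (@measurable_mulVec Ω _ _ 𝓜 _ _ _ measurable_const ih)
          (hv k (by omega)))))) (hw k (by omega))

omit mΩ in
lemma measurable_run_past (hπ : ∀ k, Measurable (π k)) (k : ℕ) {𝓜 : MeasurableSpace Ω}
    (hle : pastSigma x0 w v k ≤ 𝓜) (hv : Measurable[𝓜] (v k)) :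
    Measurable[𝓜] (fun ω => (sys.run π x0 w v k ω).x) ∧
      Measurable[𝓜] fun ω => (sys.run π x0 w v k ω).info := by
  refine @measurable_run n m p sys Ω 𝓜 π x0 w v hπ k ((measurable_x0_past k).mono hle le_rfl)
    (fun t ht => (measurable_w_past ht).mono hle le_rfl) fun t ht => ?_
  obtain ht | rfl : t < k ∨ t = k := by omega
  · exact (measurable_v_past ht).mono hle le_rfl
  · exact hv

omit mΩ in
lemma outputsBefore_le_pastSigma (hπ : ∀ k, Measurable (π k)) (k : ℕ) :
    sys.outputsBefore π x0 w v (k + 1)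
      ≤ pastSigma x0 w v k ⊔ MeasurableSpace.comap (v k) inferInstance := by
  induction k with
  | zero =>
    refine sup_le bot_le (Measurable.comap_le ?_)
    exact Measurable.comp (measurable_info_iff.1 measurable_id).2.2.2
      (measurable_run_past hπ 0 le_sup_left ((comap_measurable (v 0)).mono le_sup_right le_rfl)).2
  | succ k ih =>
    refine sup_le (ih.trans (le_sup_left.trans le_sup_left)) (Measurable.comap_le ?_)
    exact Measurable.comp (measurable_info_iff.1 measurable_id).2.2.2
      (measurable_run_past hπ (k + 1) le_sup_left
        ((comap_measurable (v (k + 1))).mono le_sup_right le_rfl)).2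

omit mΩ in
lemma outputsBefore_le_past (hπ : ∀ k, Measurable (π k)) (k : ℕ) :
    sys.outputsBefore π x0 w v k ≤ pastSigma x0 w v k := by
  cases k with
  | zero => exact bot_le
  | succ k => exact (outputsBefore_le_pastSigma hπ k).trans le_sup_left

omit mΩ in
-- State minus prediction error is the one-step prediction A x̌ + B u (or m₀ at time 0), which the
-- earlier outputs determine.
lemma measurable_prediction (hπ : ∀ k, Measurable (π k)) (k : ℕ) :
    Measurable[sys.outputsBefore π x0 w v k] fun ω => (sys.run π x0 w v k ω).x
      - sys.priorErr (x0 ω) (fun t => w t ω) (fun t => v t ω) k := by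
  cases k with
  | zero =>
    simp only [run, loop, priorErr, sub_sub_cancel]
    exact measurable_const
  | succ k =>
    have hinfo := @measurable_info_of_outputs n m p sys Ω (sys.outputsBefore π x0 w v (k + 1)) π
      x0 w v hπ k fun t ht => measurable_y_outputsBefore (by omega)
    have e : (fun ω => (sys.run π x0 w v (k + 1) ω).x
        - sys.priorErr (x0 ω) (fun t => w t ω) (fun t => v t ω) (k + 1))
        = fun ω => sys.A k *ᵥ (sys.run π x0 w v k ω).info.xchk
          + sys.B k *ᵥ sys.control k (sys.run π x0 w v k ω).info := by
      ext1 ω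
      rw [priorErr, ← filterErr, ← sys.x_sub_xchk π]
      simp only [run, loop, Matrix.mulVec_sub]
      abel
    rw [e]
    exact Measurable.add
      (@measurable_mulVec Ω _ _ (sys.outputsBefore π x0 w v (k + 1)) _ _ _ measurable_const
        ((@measurable_info_iff Ω (sys.outputsBefore π x0 w v (k + 1)) _ _ _).1 hinfo).2.2.1)
      (@measurable_mulVec Ω _ _ (sys.outputsBefore π x0 w v (k + 1)) _ _ _ measurable_const
        (@measurable_control _ _ _ sys Ω (sys.outputsBefore π x0 w v (k + 1)) k _ hinfo))

section Filter

variable [IsProbabilityMeasure P]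

omit [IsProbabilityMeasure P] in
lemma hasGaussianLaw_linear {ι κ l : Type*} [Fintype ι] [Fintype κ] [Fintype l] {X : Ω → ι → ℝ}
    {Y : Ω → κ → ℝ} (h : HasGaussianLaw (fun ω => (X ω, Y ω)) P) (F : Matrix l ι ℝ)
    (G : Matrix l κ ℝ) {r : Type*} [Fintype r] (F' : Matrix r ι ℝ)
    (G' : Matrix r κ ℝ) :
    HasGaussianLaw (fun ω => (F *ᵥ X ω + G *ᵥ Y ω, F' *ᵥ X ω + G' *ᵥ Y ω)) P :=
  h.map_fun (LinearMap.toContinuousLinearMap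
    ((F.mulVecLin.coprod G.mulVecLin).prod (F'.mulVecLin.coprod G'.mulVecLin)))

/-- Properties of the prediction error: centred Gaussian, independent of earlier outputs. -/
structure PriorOK (sys : LQGSystem n m p) (P : Measure Ω) (π : Policy n p) (x0 : Ω → Fin n → ℝ)
    (w : ℕ → Ω → Fin n → ℝ) (v : ℕ → Ω → Fin p → ℝ) (k : ℕ) : Prop where
  centred : IsCentred P (fun ω => sys.priorErr (x0 ω) (fun t => w t ω) (fun t => v t ω) k)
    (sys.priorCov k)
  gaussian : HasGaussianLaw
    (fun ω => sys.priorErr (x0 ω) (fun t => w t ω) (fun t => v t ω) k) P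
  indep : Indep (MeasurableSpace.comap
    (fun ω => sys.priorErr (x0 ω) (fun t => w t ω) (fun t => v t ω) k) inferInstance)
    (sys.outputsBefore π x0 w v k) P

/-- Properties of the filtering error: centred Gaussian, independent of the outputs so far. -/
structure FilterOK (sys : LQGSystem n m p) (P : Measure Ω) (π : Policy n p) (x0 : Ω → Fin n → ℝ)
    (w : ℕ → Ω → Fin n → ℝ) (v : ℕ → Ω → Fin p → ℝ) (k : ℕ) : Prop where
  centred : IsCentred P (fun ω => sys.filterErr (x0 ω) (fun t => w t ω) (fun t => v t ω) k)
    (sys.Sig k)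
  gaussian : HasGaussianLaw
    (fun ω => sys.filterErr (x0 ω) (fun t => w t ω) (fun t => v t ω) k) P
  indep : Indep (MeasurableSpace.comap
    (fun ω => sys.filterErr (x0 ω) (fun t => w t ω) (fun t => v t ω) k) inferInstance)
    (sys.outputsBefore π x0 w v (k + 1)) P

/-- Measurement update. Joint Gaussianity is claimed only for the error e and the innovation z = Cη
+ v, both linear in (η, v); being uncorrelated, they are independent. The output y_k is z plus a
function of earlier outputs, so e is independent of all outputs up to time k. -/
lemma PriorOK.update (hsys : sys.WellPosed) (hn : sys.IsNoise P x0 w v)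
    (hπ : ∀ k, Measurable (π k)) {k : ℕ} (h : sys.PriorOK P π x0 w v k) :
    sys.FilterOK P π x0 w v k := by
  set η : Ω → Fin n → ℝ := fun ω => sys.priorErr (x0 ω) (fun t => w t ω) (fun t => v t ω) k
    with hη
  set e : Ω → Fin n → ℝ := fun ω => sys.filterErr (x0 ω) (fun t => w t ω) (fun t => v t ω) k
    with he
  set z : Ω → Fin p → ℝ := fun ω => sys.C k *ᵥ η ω + v k ω with hz
  have hηpast : Measurable[pastSigma x0 w v k] η :=
    measurable_priorErr k (measurable_x0_past k) (fun t ht => measurable_w_past ht)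
      fun t ht => measurable_v_past ht
  have hvη : IndepFun η (v k) P := by
    rw [IndepFun_iff_Indep]
    exact (indep_of_indep_of_le_right (hn.indep_v_past k) (Measurable.comap_le hηpast)).symm
  have hG : HasGaussianLaw (fun ω => (η ω, v k ω)) P :=
    hvη.hasGaussianLaw h.gaussian (hasGaussianLaw_of_hasLaw (μ := 0) (hn.law_v k))
  have hez : ∀ ω, e ω = (1 - sys.H k * sys.C k) *ᵥ η ω + (-sys.H k) *ᵥ v k ω := fun ω => by
    simp only [he, filterErr, hη, Matrix.sub_mulVec, Matrix.one_mulVec, Matrix.neg_mulVec,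
      Matrix.mulVec_add, Matrix.mulVec_mulVec]
    abel
  have hGez : HasGaussianLaw (fun ω => (e ω, z ω)) P := by
    have := hasGaussianLaw_linear hG (1 - sys.H k * sys.C k) (-sys.H k) (sys.C k)
      (1 : Matrix (Fin p) (Fin p) ℝ)
    simpa only [← hez, Matrix.one_mulVec] using this
  have hvec : ∀ ω, Matrix.fromBlocks (1 - sys.H k * sys.C k) (-sys.H k) (sys.C k)
      (1 : Matrix (Fin p) (Fin p) ℝ) *ᵥ Sum.elim (η ω) (v k ω) = Sum.elim (e ω) (z ω) := fun ω => by
    rw [Matrix.fromBlocks_mulVec, hez]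
    simp [hz, Function.comp_def]
  -- Only the upper blocks matter: the covariance of e and its vanishing correlation with z. The
  -- lower left block is left unsimplified.
  have hcov : Matrix.fromBlocks (1 - sys.H k * sys.C k) (-sys.H k) (sys.C k)
        (1 : Matrix (Fin p) (Fin p) ℝ) * Matrix.fromBlocks (sys.priorCov k) 0 0 (sys.V k)
        * (Matrix.fromBlocks (1 - sys.H k * sys.C k) (-sys.H k) (sys.C k)
          (1 : Matrix (Fin p) (Fin p) ℝ))ᵀ
      = Matrix.fromBlocks (sys.Sig k) 0
          (sys.C k * sys.priorCov k * (1 - sys.H k * sys.C k)ᵀ - sys.V k * (sys.H k)ᵀ)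
          (sys.C k * sys.priorCov k * (sys.C k)ᵀ + sys.V k) := by
    rw [Matrix.fromBlocks_transpose, Matrix.fromBlocks_multiply, Matrix.fromBlocks_multiply]
    congr 1
    · simp only [Matrix.mul_zero, add_zero, zero_add, Matrix.neg_mul, Matrix.transpose_neg,
        Matrix.mul_neg, neg_neg]
      exact joseph_eq hsys k
    · simp only [Matrix.mul_zero, add_zero, zero_add, Matrix.neg_mul, Matrix.transpose_one,
        Matrix.mul_one]
      rw [cross_cov_eq_zero hsys, add_neg_cancel]
    · simp [sub_eq_add_neg]
    · simp
  have hc : IsCentred P (fun ω => Sum.elim (e ω) (z ω)) (Matrix.fromBlocks (sys.Sig k) 0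
      (sys.C k * sys.priorCov k * (1 - sys.H k * sys.C k)ᵀ - sys.V k * (sys.H k)ᵀ)
      (sys.C k * sys.priorCov k * (sys.C k)ᵀ + sys.V k)) := by
    rw [← hcov, ← funext hvec]
    exact (h.centred.stack (hn.isCentred_v hsys k) hvη).mulVec _
  have hme : Measurable e := measurable_pi_lambda _ fun i =>
    (measurable_pi_apply (Sum.inl i)).comp hc.measurable
  have hmz : Measurable z := measurable_pi_lambda _ fun i =>
    (measurable_pi_apply (Sum.inr i)).comp hc.measurable
  have hind : IndepFun e z P := by
    refine HasGaussianLaw.indepFun_of_covariance_eval (X := fun i ω => e ω i)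
      (Y := fun j ω => z ω j) hGez fun i j => ?_
    have h1 := hc.cov (Sum.inl i) (Sum.inr j)
    have h2 := hc.mean (Sum.inl i)
    have h3 := hc.mean (Sum.inr j)
    simp only [Sum.elim_inl, Sum.elim_inr, Matrix.fromBlocks_apply₁₂, Matrix.zero_apply]
      at h1 h2 h3
    simp only [covariance, h2, h3, sub_zero, h1]
  have hout : sys.outputsBefore π x0 w v k ≤ mΩ :=
    (outputsBefore_le_past hπ k).trans (hn.pastSigma_le k)
  have hηm : Measurable η := h.centred.measurable
  -- First (η, v_k), hence (e, z), is independent of the earlier outputs; together with independence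
  -- of e and z this frees e from z and the earlier outputs jointly.
  have h1 := indep_sup_of_indep hηm.comap_le hout (hn.measurable_v k).comap_le h.indep
    (indep_of_indep_of_le_right (hn.indep_v_past k)
      (sup_le (Measurable.comap_le hηpast) (outputsBefore_le_past hπ k)))
  have hη' : Measurable[MeasurableSpace.comap η inferInstance
      ⊔ MeasurableSpace.comap (v k) inferInstance] η :=
    (comap_measurable η).mono le_sup_left le_rfl
  have hv' : Measurable[MeasurableSpace.comap η inferInstance
      ⊔ MeasurableSpace.comap (v k) inferInstance] (v k) :=
    (comap_measurable (v k)).mono le_sup_right le_rfl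
  have hz' : Measurable[MeasurableSpace.comap η inferInstance
      ⊔ MeasurableSpace.comap (v k) inferInstance] z :=
    Measurable.add (@measurable_mulVec Ω _ _ (_) _ _ _ measurable_const hη') hv'
  have he' : Measurable[MeasurableSpace.comap η inferInstance
      ⊔ MeasurableSpace.comap (v k) inferInstance] e :=
    Measurable.sub hη' (@measurable_mulVec Ω _ _ (_) _ _ _ measurable_const hz')
  have h2 := indep_sup_of_indep hmz.comap_le hme.comap_le hout
    ((IndepFun_iff_Indep _ _ _).1 hind.symm)
    (indep_of_indep_of_le_right h1.symm (sup_le hz'.comap_le he'.comap_le))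
  refine ⟨?_, hGez.fst, indep_of_indep_of_le_right h2.symm ?_⟩
  · exact ⟨hme, fun i => hc.memLp (Sum.inl i), fun i => hc.mean (Sum.inl i),
      fun i j => hc.cov (Sum.inl i) (Sum.inl j)⟩
  · refine sup_le le_sup_right (Measurable.comap_le ?_)
    have e1 : (fun ω => (sys.run π x0 w v k ω).info.y)
        = fun ω => sys.C k *ᵥ ((sys.run π x0 w v k ω).x - η ω) + z ω := by
      ext1 ω
      simp only [run, loop_y, hz, Matrix.mulVec_sub]
      abel
    rw [e1]
    exact Measurable.add (@measurable_mulVec Ω _ _ (_) _ _ _ measurable_const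
      ((measurable_prediction hπ k).mono le_sup_right le_rfl))
      ((comap_measurable z).mono le_sup_left le_rfl)

/-- Time update: the new prediction error is A e + w_k, with w_k independent of e and of the outputs
up to time k. -/
lemma FilterOK.predict (hsys : sys.WellPosed) (hn : sys.IsNoise P x0 w v)
    (hπ : ∀ k, Measurable (π k)) {k : ℕ} (h : sys.FilterOK P π x0 w v k) :
    sys.PriorOK P π x0 w v (k + 1) := by
  set e : Ω → Fin n → ℝ := fun ω => sys.filterErr (x0 ω) (fun t => w t ω) (fun t => v t ω) k
    with he
  have hη : (fun ω => sys.priorErr (x0 ω) (fun t => w t ω) (fun t => v t ω) (k + 1))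
      = fun ω => sys.A k *ᵥ e ω + w k ω := rfl
  have hepast : Measurable[pastSigma x0 w v k ⊔ MeasurableSpace.comap (v k) inferInstance] e := by
    have h1 : Measurable[pastSigma x0 w v k ⊔ MeasurableSpace.comap (v k) inferInstance]
        fun ω => sys.priorErr (x0 ω) (fun t => w t ω) (fun t => v t ω) k :=
      (measurable_priorErr k (measurable_x0_past k) (fun t ht => measurable_w_past ht)
        fun t ht => measurable_v_past ht).mono le_sup_left le_rfl
    exact Measurable.sub h1 (@measurable_mulVec Ω _ _ (_) _ _ _ measurable_const
      (Measurable.add (@measurable_mulVec Ω _ _ (_) _ _ _ measurable_const h1)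
        ((comap_measurable (v k)).mono le_sup_right le_rfl)))
  have hew : IndepFun e (w k) P := by
    rw [IndepFun_iff_Indep]
    exact (indep_of_indep_of_le_right (hn.indep_w_past k) (Measurable.comap_le hepast)).symm
  have hG : HasGaussianLaw (fun ω => (e ω, w k ω)) P :=
    hew.hasGaussianLaw h.gaussian (hasGaussianLaw_of_hasLaw (μ := 0) (hn.law_w k))
  have hc := (h.centred.stack (hn.isCentred_w hsys k) hew).mulVec
    (Matrix.fromCols (sys.A k) (1 : Matrix (Fin n) (Fin n) ℝ))
  have hout : sys.outputsBefore π x0 w v (k + 1) ≤ mΩ :=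
    (outputsBefore_le_past hπ (k + 1)).trans (hn.pastSigma_le (k + 1))
  have hind := indep_sup_of_indep h.centred.measurable.comap_le hout (hn.measurable_w k).comap_le
    h.indep (indep_of_indep_of_le_right (hn.indep_w_past k)
      (sup_le (Measurable.comap_le hepast) (outputsBefore_le_pastSigma hπ k)))
  refine ⟨?_, ?_, indep_of_indep_of_le_left hind ?_⟩
  · rw [hη]
    simpa [Matrix.fromCols_mulVec_sumElim, Matrix.transpose_fromCols,
      Matrix.fromCols_mul_fromBlocks, Matrix.fromCols_mul_fromRows, priorCov] using hc
  · rw [hη]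
    have := hasGaussianLaw_linear hG (sys.A k) (1 : Matrix (Fin n) (Fin n) ℝ) (sys.A k)
      (1 : Matrix (Fin n) (Fin n) ℝ)
    simpa only [Matrix.one_mulVec] using this.fst
  · rw [hη]
    refine Measurable.comap_le ?_
    exact Measurable.add (@measurable_mulVec Ω _ _ (_) _ _ _ measurable_const
      ((comap_measurable e).mono le_sup_left le_rfl))
      ((comap_measurable (w k)).mono le_sup_right le_rfl)

lemma filterOK (hsys : sys.WellPosed) (hn : sys.IsNoise P x0 w v) (hπ : ∀ k, Measurable (π k))
    (k : ℕ) : sys.FilterOK P π x0 w v k := by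
  suffices h : sys.PriorOK P π x0 w v k from h.update hsys hn hπ
  induction k with
  | zero =>
    refine ⟨hn.isCentred_x0 hsys, ?_, indep_bot_right _⟩
    have h := (hasGaussianLaw_of_hasLaw hn.law_x0).isGaussian_map
    refine ⟨?_⟩
    have e : P.map (fun ω => x0 ω - sys.m₀) = (P.map x0).map (fun x => x - sys.m₀) :=
      (Measure.map_map (g := fun x => x - sys.m₀) (by fun_prop) hn.measurable_x0).symm
    change IsGaussian (P.map fun ω => x0 ω - sys.m₀)
    rw [e]
    simp only [sub_eq_add_neg]
    infer_instance
  | succ k ih => exact (ih.update hsys hn hπ).predict hsys hn hπ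

omit [IsProbabilityMeasure P] in
lemma outputSigma_le (hn : sys.IsNoise P x0 w v) (hπ : ∀ k, Measurable (π k)) (k : ℕ) :
    sys.outputSigma π x0 w v k ≤ mΩ :=
  ((outputSigma_le_outputsBefore k).trans (outputsBefore_le_past hπ (k + 1))).trans
    (hn.pastSigma_le (k + 1))

/-- The filter of the event trigger computes the conditional mean and covariance. -/
lemma centredCond_x_sub_xchk (hsys : sys.WellPosed) (hn : sys.IsNoise P x0 w v)
    (hπ : ∀ k, Measurable (π k)) (k : ℕ) :
    CentredCond (sys.outputSigma π x0 w v k) P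
      (fun ω => (sys.run π x0 w v k ω).x - (sys.run π x0 w v k ω).info.xchk)
      fun _ => sys.Sig k := by
  have h := filterOK hsys hn hπ k
  refine (h.centred.centredCond (outputSigma_le hn hπ k)
    (indep_of_indep_of_le_right h.indep (outputSigma_le_outputsBefore k))).congr
    (fun ω => (sys.x_sub_xchk π _ _ _ k).symm) fun _ => rfl

end Filter

end LQGSystem

end EventTriggered

namespace EventTriggered.LQGSystem

variable {n m p : ℕ} {sys : LQGSystem n m p} {Ω : Type*} [mΩ : MeasurableSpace Ω] {P : Measure Ω}
  [IsProbabilityMeasure P] {x0 : Ω → Fin n → ℝ} {w : ℕ → Ω → Fin n → ℝ} {v : ℕ → Ω → Fin p → ℝ}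
  {π base : Policy n p}

/-! ### Square integrability of the closed loop -/

omit [IsProbabilityMeasure P] in
lemma measurable_run_ambient (hn : sys.IsNoise P x0 w v) (hπ : ∀ k, Measurable (π k)) (k : ℕ) :
    Measurable (fun ω => (sys.run π x0 w v k ω).x) ∧
      Measurable fun ω => (sys.run π x0 w v k ω).info :=
  measurable_run sys hπ k hn.measurable_x0 (fun t _ => hn.measurable_w t)
    fun t _ => hn.measurable_v t

omit [IsProbabilityMeasure P] in
lemma memLp_x0 (hn : sys.IsNoise P x0 w v) (i : Fin n) : MemLp (fun ω => x0 ω i) 2 P :=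
  MemLp.eval (hasGaussianLaw_of_hasLaw hn.law_x0).memLp_two i

/-- One step is linear with constant coefficients apart from the transmitted correction, whose gain
takes finitely many values; square integrability therefore propagates. -/
lemma memLp_run (hsys : sys.WellPosed) (hn : sys.IsNoise P x0 w v) (hπ : ∀ k, Measurable (π k))
    (k : ℕ) : (∀ i, MemLp (fun ω => (sys.run π x0 w v k ω).x i) 2 P) ∧
      ∀ i, MemLp (fun ω => (sys.run π x0 w v k ω).info.xhat i) 2 P := by
  induction k with
  | zero => exact ⟨memLp_x0 hn, fun i => memLp_const _⟩
  | succ k ih =>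
    obtain ⟨hx, hxh⟩ := ih
    have hw := (hn.isCentred_w hsys k).memLp
    have hv := (hn.isCentred_v hsys k).memLp
    have hu : ∀ i, MemLp (fun ω => sys.control k (sys.run π x0 w v k ω).info i) 2 P := fun i =>
      (memLp_const_mulVec (sys.L k) hxh i).neg
    have hν : ∀ i, MemLp (fun ω => sys.nu k (sys.run π x0 w v k ω).info i) 2 P := fun i => by
      simp only [nu, run, loop_y]
      exact ((memLp_const_mulVec (sys.C k) hx i).add (hv i)).sub
        (memLp_const_mulVec (sys.C k) hxh i)
    have hs := (measurable_run_ambient hn hπ k).2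
    set gain : Bool × Matrix (Fin n) (Fin n) ℝ → Matrix (Fin n) (Fin p) ℝ :=
      fun q => if q.1 then sys.K k q.2 else 0
    obtain ⟨T, hT, hmem⟩ := exists_finite_cov sys k
    have hb := bddMat_of_finite (Ω := Ω) (Set.finite_univ.prod hT) gain
      (s := fun ω => (π k (sys.run π x0 w v k ω).info, (sys.run π x0 w v k ω).info.P))
      fun ω => ⟨Set.mem_univ _, hmem _ _ _ _⟩
    have hgm : Measurable fun ω =>
        gain (π k (sys.run π x0 w v k ω).info, (sys.run π x0 w v k ω).info.P) :=
      measurable_bool_ite ((hπ k).comp hs) (measurable_K sys k (measurable_info_iff.1 hs).2.1)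
        measurable_const
    have hgν := memLp_mulVec hgm hb hν
    refine ⟨fun i => ?_, fun i => ?_⟩
    · exact ((memLp_const_mulVec (sys.A k) hx i).add
        (memLp_const_mulVec (sys.B k) hu i)).add (hw i)
    · refine (((memLp_const_mulVec (sys.A k) hxh i).add
        (memLp_const_mulVec (sys.B k) hu i)).add (hgν i)).congr_norm ?_ (.of_forall fun ω => ?_)
      · exact ((measurable_pi_apply i).comp (measurable_info_iff.1
          (measurable_run_ambient hn hπ (k + 1)).2).1).aestronglyMeasurable
      · simp only [run, loop, gain, Pi.add_apply]
        split_ifs <;> simp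

lemma memLp_control (hsys : sys.WellPosed) (hn : sys.IsNoise P x0 w v)
    (hπ : ∀ k, Measurable (π k)) (k : ℕ) (i : Fin m) :
    MemLp (fun ω => sys.control k (sys.run π x0 w v k ω).info i) 2 P :=
  (memLp_const_mulVec (sys.L k) (memLp_run hsys hn hπ k).2 i).neg

lemma memLp_error (hsys : sys.WellPosed) (hn : sys.IsNoise P x0 w v) (hπ : ∀ k, Measurable (π k))
    (k : ℕ) (i : Fin n) :
    MemLp (fun ω => ((sys.run π x0 w v k ω).x - (sys.run π x0 w v k ω).info.xhat) i) 2 P :=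
  ((memLp_run hsys hn hπ k).1 i).sub ((memLp_run hsys hn hπ k).2 i)

omit [IsProbabilityMeasure P] in
lemma integrable_quadratic {ι : Type*} [Fintype ι] {X : Ω → ι → ℝ}
    (hX : ∀ i, MemLp (fun ω => X ω i) 2 P) (G : Matrix ι ι ℝ) :
    Integrable (fun ω => X ω ⬝ᵥ (G *ᵥ X ω)) P :=
  integrable_dotProduct hX (memLp_const_mulVec G hX)

lemma integrable_price (hn : sys.IsNoise P x0 w v) (hπ : ∀ k, Measurable (π k)) (k : ℕ) :
    Integrable (fun ω => sys.θ k * if π k (sys.run π x0 w v k ω).info then (1 : ℝ) else 0) P := by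
  refine Integrable.const_mul ?_ _
  refine Integrable.of_bound (C := 1) (measurable_bool_ite
    ((hπ k).comp (measurable_run_ambient hn hπ k).2) measurable_const
    measurable_const).aestronglyMeasurable (.of_forall fun ω => ?_)
  split_ifs <;> simp

/-- Price of the decision at time `t` plus the weighted error at time `t + 1`. -/
noncomputable def stageLoss (sys : LQGSystem n m p) (π : Policy n p) (x0 : Ω → Fin n → ℝ)
    (w : ℕ → Ω → Fin n → ℝ) (v : ℕ → Ω → Fin p → ℝ) (t : ℕ) (ω : Ω) : ℝ :=
  (sys.θ t * if π t (sys.run π x0 w v t ω).info then 1 else 0)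
    + ((sys.run π x0 w v (t + 1) ω).x - (sys.run π x0 w v (t + 1) ω).info.xhat) ⬝ᵥ
      (sys.Γ (t + 1) *ᵥ
        ((sys.run π x0 w v (t + 1) ω).x - (sys.run π x0 w v (t + 1) ω).info.xhat))

omit mΩ in
lemma costToGo_eq (k : ℕ) (ω : Ω) : sys.costToGo π x0 w v k ω
    = ∑ t ∈ Finset.Icc (k + 1) sys.N, sys.stageLoss π x0 w v t ω := rfl

lemma integrable_stageLoss (hsys : sys.WellPosed) (hn : sys.IsNoise P x0 w v)
    (hπ : ∀ k, Measurable (π k)) (t : ℕ) : Integrable (sys.stageLoss π x0 w v t) P :=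
  (integrable_price hn hπ t).add (integrable_quadratic (memLp_error hsys hn hπ (t + 1)) _)

lemma integrable_costToGo (hsys : sys.WellPosed) (hn : sys.IsNoise P x0 w v)
    (hπ : ∀ k, Measurable (π k)) (k : ℕ) : Integrable (sys.costToGo π x0 w v k) P :=
  integrable_finsetSum _ fun t _ => integrable_stageLoss hsys hn hπ t

/-! ### The closed loop after a deviation -/

/-- Initial condition of the propagation after the decision `d` at time `k`. -/
noncomputable def initOf (sys : LQGSystem n m p) (k : ℕ) (d : Bool) (s : Info n p) :
    (Fin n → ℝ) × Matrix (Fin n) (Fin n) ℝ × Matrix (Fin n) (Fin n) ℝ :=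
  if d then sys.init1 k s else sys.init0 k s

/-- Mean, covariance and controller covariance at time `k + 1 + j` after the decision `d` at
time `k`, when every later output is transmitted. -/
noncomputable def forecast (sys : LQGSystem n m p) (π : Policy n p) (x0 : Ω → Fin n → ℝ)
    (w : ℕ → Ω → Fin n → ℝ) (v : ℕ → Ω → Fin p → ℝ) (k : ℕ) (d : Bool) (j : ℕ) (ω : Ω) :
    (Fin n → ℝ) × Matrix (Fin n) (Fin n) ℝ × Matrix (Fin n) (Fin n) ℝ :=
  sys.propag (k + 1) (sys.initOf k d (sys.run π x0 w v k ω).info) j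

omit mΩ in
lemma run_deviate {k t : ℕ} (ht : t ≤ k) (d : Bool) (ω : Ω) :
    sys.run (deviate π base k d) x0 w v t ω = sys.run π x0 w v t ω :=
  (loop_congr sys t fun s hs => by simp [deviate, hs.trans_le ht]).symm

omit mΩ in
lemma deviate_apply_self {k : ℕ} (d : Bool) (s : Info n p) : deviate π base k d k s = d := by
  simp [deviate]

omit mΩ in
lemma deviate_periodic_apply {k t : ℕ} (ht : k < t) (d : Bool) (s : Info n p) :
    deviate π (periodicPolicy n p 1) k d t s = true := by
  simp [deviate, periodicPolicy, ht.not_gt, ht.ne']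

omit mΩ in
lemma run_succ_cov (π : Policy n p) (k : ℕ) (ω : Ω) : (sys.run π x0 w v (k + 1) ω).info.P
    = sys.covStep k (π k (sys.run π x0 w v k ω).info) (sys.run π x0 w v k ω).info.P := rfl

omit mΩ in
-- With all decisions from time k on prescribed, the later covariances, and so the gains, are
-- functions of the data at time k. The gains can then be pulled out of conditional expectations.
lemma cov_deviate (k : ℕ) (d : Bool) (j : ℕ) (ω : Ω) :
    (sys.run (deviate π (periodicPolicy n p 1) k d) x0 w v (k + 1 + j) ω).info.P
      = (sys.forecast π x0 w v k d j ω).2.2 := by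
  induction j with
  | zero =>
    rw [add_zero, run_succ_cov, deviate_apply_self, run_deviate le_rfl, forecast, propag]
    cases d
    · simp only [covStep, initOf, init0, Bool.false_eq_true, if_false, sub_zero]
    · simp only [covStep, initOf, init1, if_true]
  | succ j ih =>
    rw [← add_assoc, run_succ_cov, deviate_periodic_apply (by omega), ih]
    simp only [covStep, if_true, forecast, propag]

omit mΩ in
-- The data at time k + 1 contain v_{k+1} through y_{k+1}, but the controller error does not:
-- transmission is delayed by one step.
lemma measurable_error_succ_past (hπ : ∀ k, Measurable (π k)) (k : ℕ) :
    Measurable[pastSigma x0 w v (k + 1)] fun ω =>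
      (sys.run π x0 w v (k + 1) ω).x - (sys.run π x0 w v (k + 1) ω).info.xhat := by
  have hle : pastSigma x0 w v k ≤ pastSigma x0 w v (k + 1) := pastSigma_mono k.le_succ
  obtain ⟨hx, hs⟩ := measurable_run_past (sys := sys) hπ k hle (measurable_v_past k.lt_succ_self)
  have hs' := (@measurable_info_iff Ω (pastSigma x0 w v (k + 1)) _ _ _).1 hs
  simp only [run, error_succ]
  exact Measurable.sub (Measurable.add (@measurable_mulVec Ω _ _ (_) _ _ _ measurable_const
    (Measurable.sub hx hs'.1)) (measurable_w_past k.lt_succ_self))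
    (@measurable_bool_ite Ω (_) _ _ _ (Measurable.comp (hπ k) hs) _ _
      (@measurable_mulVec Ω _ _ (_) _ _ _ (@measurable_K _ _ _ sys Ω (_) k _ hs'.2.1)
        (@measurable_nu _ _ _ sys Ω (_) k _ hs)) measurable_const)

omit mΩ in
lemma measurable_forecast (hπ : ∀ k, Measurable (π k)) (k : ℕ) (d : Bool) (j : ℕ) :
    Measurable[sys.outputSigma π x0 w v k] fun ω => sys.forecast π x0 w v k d j ω := by
  have hs := measurable_info_outputSigma (sys := sys) (x0 := x0) (w := w) (v := v) hπ k
  refine @measurable_propag _ _ _ sys Ω (sys.outputSigma π x0 w v k) (k + 1) _ ?_ j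
  cases d
  · exact @measurable_init0 _ _ _ sys Ω (sys.outputSigma π x0 w v k) k _ hs
  · exact @measurable_init1 _ _ _ sys Ω (sys.outputSigma π x0 w v k) k _ hs

lemma outputSigma_le_past (hπ : ∀ k, Measurable (π k)) (k : ℕ) :
    sys.outputSigma π x0 w v k ≤ pastSigma x0 w v k ⊔ MeasurableSpace.comap (v k) inferInstance :=
  (outputSigma_le_outputsBefore k).trans (outputsBefore_le_pastSigma hπ k)

/-- Conditional law (first two moments) of the estimation error after a deviation. -/
lemma centredCond_error (hsys : sys.WellPosed) (hn : sys.IsNoise P x0 w v)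
    (hπ : ∀ k, Measurable (π k)) (k : ℕ) (d : Bool) (j : ℕ) :
    CentredCond (sys.outputSigma π x0 w v k) P
      (fun ω => ((sys.run (deviate π (periodicPolicy n p 1) k d) x0 w v (k + 1 + j) ω).x
        - (sys.run (deviate π (periodicPolicy n p 1) k d) x0 w v (k + 1 + j) ω).info.xhat)
        - (sys.forecast π x0 w v k d j ω).1)
      fun ω => (sys.forecast π x0 w v k d j ω).2.1 := by
  have hdev : ∀ t, Measurable (deviate π (periodicPolicy n p 1) k d t) :=
    measurable_deviate hπ (measurable_periodicPolicy 1) k d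
  have hY := outputSigma_le (P := P) (sys := sys) hn hπ k
  have hYpast := outputSigma_le_past (sys := sys) (x0 := x0) (w := w) (v := v) hπ k
  induction j with
  | zero =>
    have h𝓖 : pastSigma x0 w v k ⊔ MeasurableSpace.comap (v k) inferInstance ≤ mΩ :=
      sup_le (hn.pastSigma_le k) (hn.measurable_v k).comap_le
    have h0 := centredCond_x_sub_xchk (P := P) hsys hn hπ k
    obtain ⟨hx, hs⟩ := measurable_run_past (sys := sys) hπ k
      le_sup_left ((comap_measurable (v k)).mono le_sup_right le_rfl)
    have hs' := (@measurable_info_iff Ω (_) _ _ _).1 hs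
    have hem : Measurable[pastSigma x0 w v k ⊔ MeasurableSpace.comap (v k) inferInstance] fun ω =>
        (sys.run π x0 w v k ω).x - (sys.run π x0 w v k ω).info.xchk := Measurable.sub hx hs'.2.2.1
    have hemi : ∀ i, Measurable[pastSigma x0 w v k ⊔ MeasurableSpace.comap (v k) inferInstance]
        fun ω => ((sys.run π x0 w v k ω).x - (sys.run π x0 w v k ω).info.xchk) i := fun i =>
      Measurable.comp (measurable_pi_apply i) hem
    have hw := hn.isCentred_w hsys k
    -- At time k + 1 the error minus its forecast is A(x - x̌) + w_k, whichever decision is taken: a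
    -- transmitted correction is known and sits in the forecast mean.
    have h1 := ((h0.stack (hw.centredCond hY
      (indep_of_indep_of_le_right (hn.indep_w_past k) hYpast))
      fun i j => hw.condExp_mul_eq_zero hYpast h𝓖 (hn.indep_w_past k) (hemi i)
        (h0.memLp i) j).mulVec hY
      (F := fun _ => Matrix.fromCols (sys.A k) (1 : Matrix (Fin n) (Fin n) ℝ))
      measurable_const (bddMat_const _))
    refine h1.congr (fun ω => ?_) fun ω => ?_
    · have e1 : sys.run (deviate π (periodicPolicy n p 1) k d) x0 w v k ω
          = sys.run π x0 w v k ω := run_deviate le_rfl d ω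
      have e2 := sys.error_succ (deviate π (periodicPolicy n p 1) k d) (x0 ω) (fun t => w t ω)
        (fun t => v t ω) k
      rw [deviate_apply_self] at e2
      rw [Matrix.fromCols_mulVec_sumElim, Matrix.one_mulVec]
      change _ = (sys.loop (deviate π (periodicPolicy n p 1) k d) (x0 ω) (fun t => w t ω)
        (fun t => v t ω) (k + 1)).x - (sys.loop (deviate π (periodicPolicy n p 1) k d) (x0 ω)
          (fun t => w t ω) (fun t => v t ω) (k + 1)).info.xhat - _
      rw [e2]
      change _ = sys.A k *ᵥ ((sys.run (deviate π (periodicPolicy n p 1) k d) x0 w v k ω).x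
        - (sys.run (deviate π (periodicPolicy n p 1) k d) x0 w v k ω).info.xhat) + w k ω
        - (if d then sys.K k (sys.run (deviate π (periodicPolicy n p 1) k d) x0 w v k ω).info.P
          *ᵥ sys.nu k (sys.run (deviate π (periodicPolicy n p 1) k d) x0 w v k ω).info else 0) - _
      rw [e1, forecast, propag]
      cases d
      · simp only [initOf, init0, eps, Bool.false_eq_true, if_false, sub_zero, Matrix.mulVec_sub]
        abel
      · simp only [initOf, init1, eps, if_true, Matrix.mulVec_sub]
        abel
    · have e3 : (sys.forecast π x0 w v k d 0 ω).2.1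
          = sys.A k * sys.Sig k * (sys.A k)ᵀ + sys.W k := by
        rw [forecast, propag]
        cases d <;> rfl
      rw [e3]
      simp [Matrix.transpose_fromCols, Matrix.fromCols_mul_fromBlocks, Matrix.fromCols_mul_fromRows]
  | succ j ih =>
    have hYt : sys.outputSigma π x0 w v k ≤ pastSigma x0 w v (k + 1 + j) :=
      hYpast.trans (le_sup_left.trans (pastSigma_mono (by omega : k + 1 ≤ k + 1 + j)))
    have hfm := measurable_forecast (sys := sys) (x0 := x0) (w := w) (v := v) hπ k d j
    have hem : Measurable[pastSigma x0 w v (k + 1 + j)] fun ω =>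
        ((sys.run (deviate π (periodicPolicy n p 1) k d) x0 w v (k + 1 + j) ω).x
          - (sys.run (deviate π (periodicPolicy n p 1) k d) x0 w v (k + 1 + j) ω).info.xhat)
          - (sys.forecast π x0 w v k d j ω).1 := by
      have h1 := measurable_error_succ_past (sys := sys) (x0 := x0) (w := w) (v := v) hdev (k + j)
      rw [show k + j + 1 = k + 1 + j by omega] at h1
      exact Measurable.sub h1 (Measurable.fst (hfm.mono hYt le_rfl))
    obtain ⟨T, hT, hmem⟩ := exists_finite_cov sys (k + 1 + j)
    -- Forecast covariances are covariances of an actual loop, hence lie in the finite set and bound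
    -- the gains.
    have hPT : ∀ ω, (sys.forecast π x0 w v k d j ω).2.2 ∈ T := fun ω => by
      rw [← cov_deviate]; exact hmem _ _ _ _
    have hKm := @measurable_K _ _ _ sys Ω (sys.outputSigma π x0 w v k) (k + 1 + j) _
      (Measurable.snd (Measurable.snd hfm))
    -- The conditioning σ-algebra stays at time k; only the σ-algebra that holds the current error
    -- grows, and the noises at time k + 1 + j are fresh for it.
    have h1 := ih.step hYt (hn.pastSigma_le _) hem (hn.isCentred_v hsys (k + 1 + j))
      (hn.isCentred_w hsys (k + 1 + j)) (hn.indep_v_past _) (hn.indep_w_past _)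
      (F := fun ω => sys.A (k + 1 + j) - sys.K (k + 1 + j) (sys.forecast π x0 w v k d j ω).2.2
        * sys.C (k + 1 + j))
      (K := fun ω => sys.K (k + 1 + j) (sys.forecast π x0 w v k d j ω).2.2)
      (@measurable_matrix_sub Ω _ _ (_) _ _ measurable_const
        (@measurable_matrix_mul Ω _ _ _ (_) _ _ _ hKm measurable_const)) hKm
      (bddMat_of_finite hT (fun M => sys.A (k + 1 + j) - sys.K (k + 1 + j) M * sys.C (k + 1 + j))
        hPT)
      (bddMat_of_finite hT (sys.K (k + 1 + j)) hPT)
    refine h1.congr (fun ω => ?_) fun ω => rfl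
    have e2 := sys.error_succ (deviate π (periodicPolicy n p 1) k d) (x0 ω) (fun t => w t ω)
      (fun t => v t ω) (k + 1 + j)
    rw [deviate_periodic_apply (by omega), if_pos rfl] at e2
    have e3 : (sys.loop (deviate π (periodicPolicy n p 1) k d) (x0 ω) (fun t => w t ω)
        (fun t => v t ω) (k + 1 + j)).info.P = (sys.forecast π x0 w v k d j ω).2.2 :=
      cov_deviate k d j ω
    rw [e3, nu, loop_y] at e2
    have e4 : (sys.forecast π x0 w v k d (j + 1) ω).1
        = (sys.A (k + 1 + j) - sys.K (k + 1 + j) (sys.forecast π x0 w v k d j ω).2.2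
          * sys.C (k + 1 + j)) *ᵥ (sys.forecast π x0 w v k d j ω).1 := rfl
    rw [e4]
    change _ = (sys.loop (deviate π (periodicPolicy n p 1) k d) (x0 ω) (fun t => w t ω)
      (fun t => v t ω) (k + 1 + j + 1)).x - (sys.loop (deviate π (periodicPolicy n p 1) k d) (x0 ω)
        (fun t => w t ω) (fun t => v t ω) (k + 1 + j + 1)).info.xhat - _
    rw [e2]
    simp only [run, Matrix.sub_mulVec, Matrix.mulVec_sub, Matrix.mulVec_add, Matrix.mulVec_mulVec]
    abel

/-- Conditional expectation of the weighted error after a deviation. -/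
lemma condExp_error_quadratic (hsys : sys.WellPosed) (hn : sys.IsNoise P x0 w v)
    (hπ : ∀ k, Measurable (π k)) (k : ℕ) (d : Bool) (j : ℕ) (G : Matrix (Fin n) (Fin n) ℝ) :
    P[fun ω => ((sys.run (deviate π (periodicPolicy n p 1) k d) x0 w v (k + 1 + j) ω).x
        - (sys.run (deviate π (periodicPolicy n p 1) k d) x0 w v (k + 1 + j) ω).info.xhat) ⬝ᵥ
      (G *ᵥ ((sys.run (deviate π (periodicPolicy n p 1) k d) x0 w v (k + 1 + j) ω).x
        - (sys.run (deviate π (periodicPolicy n p 1) k d) x0 w v (k + 1 + j) ω).info.xhat))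
      | sys.outputSigma π x0 w v k]
    =ᵐ[P] fun ω => (sys.forecast π x0 w v k d j ω).1 ⬝ᵥ (G *ᵥ (sys.forecast π x0 w v k d j ω).1)
      + (G * (sys.forecast π x0 w v k d j ω).2.1).trace := by
  have hdev : ∀ t, Measurable (deviate π (periodicPolicy n p 1) k d t) :=
    measurable_deviate hπ (measurable_periodicPolicy 1) k d
  have h := centredCond_error (P := P) hsys hn hπ k d j
  -- The forecast mean is the error minus its centred remainder, so it inherits square
  -- integrability.
  have hL : ∀ i, MemLp (fun ω => (sys.forecast π x0 w v k d j ω).1 i) 2 P := fun i => by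
    refine ((memLp_error hsys hn hdev (k + 1 + j) i).sub (h.memLp i)).ae_eq (.of_forall fun ω => ?_)
    simp
  have := h.condExp_quadratic (outputSigma_le hn hπ k)
    (Measurable.fst (measurable_forecast (sys := sys) (x0 := x0) (w := w) (v := v) hπ k d j)) hL G
  simpa only [add_sub_cancel] using this

/-- From time k on the decisions are prescribed, so the price is a constant, which vanishes only for
t = k without transmission. Stage t carries the error at time t + 1, which is why the forecast index
is t - k. -/
lemma condExp_stageLoss (hsys : sys.WellPosed) (hn : sys.IsNoise P x0 w v)
    (hπ : ∀ k, Measurable (π k)) {k t : ℕ} (ht : k ≤ t) (d : Bool) :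
    P[sys.stageLoss (deviate π (periodicPolicy n p 1) k d) x0 w v t | sys.outputSigma π x0 w v k]
    =ᵐ[P] fun ω => (sys.θ t * if t = k ∧ d = false then 0 else 1)
      + ((sys.forecast π x0 w v k d (t - k) ω).1 ⬝ᵥ
          (sys.Γ (t + 1) *ᵥ (sys.forecast π x0 w v k d (t - k) ω).1)
        + (sys.Γ (t + 1) * (sys.forecast π x0 w v k d (t - k) ω).2.1).trace) := by
  have hdev : ∀ t, Measurable (deviate π (periodicPolicy n p 1) k d t) :=
    measurable_deviate hπ (measurable_periodicPolicy 1) k d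
  have hY := outputSigma_le (P := P) (sys := sys) hn hπ k
  obtain ⟨j, rfl⟩ := Nat.exists_eq_add_of_le ht
  have e1 : sys.stageLoss (deviate π (periodicPolicy n p 1) k d) x0 w v (k + j)
      = (fun _ => sys.θ (k + j) * if k + j = k ∧ d = false then (0 : ℝ) else 1)
        + fun ω => ((sys.run (deviate π (periodicPolicy n p 1) k d) x0 w v (k + 1 + j) ω).x
          - (sys.run (deviate π (periodicPolicy n p 1) k d) x0 w v (k + 1 + j) ω).info.xhat) ⬝ᵥ
        (sys.Γ (k + j + 1) *ᵥ
          ((sys.run (deviate π (periodicPolicy n p 1) k d) x0 w v (k + 1 + j) ω).x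
          - (sys.run (deviate π (periodicPolicy n p 1) k d) x0 w v (k + 1 + j) ω).info.xhat)) := by
    ext ω
    rw [stageLoss, Pi.add_apply, show k + 1 + j = k + j + 1 by omega]
    congr 2
    rcases Nat.eq_zero_or_pos j with rfl | hj
    · simp only [add_zero, deviate_apply_self]
      cases d <;> simp
    · rw [deviate_periodic_apply (by omega)]
      simp [hj.ne']
  have hq := integrable_quadratic (memLp_error hsys hn hdev (k + 1 + j)) (sys.Γ (k + j + 1))
  rw [e1]
  filter_upwards [condExp_add (integrable_const (μ := P) _) hq (sys.outputSigma π x0 w v k),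
    condExp_error_quadratic (P := P) hsys hn hπ k d j (sys.Γ (k + j + 1))] with ω h1 h2
  rw [h1, Pi.add_apply, h2, condExp_const hY]
  simp

omit mΩ in
-- Stages t = k+1, …, N carry errors at times k+2, …, N+1; the last drops out because Γ_{N+1} = 0,
-- which gives the range k+2, …, N of the closed form.
lemma sum_forecast_eq_tailSum {k : ℕ} (d : Bool) (ω : Ω) :
    ∑ t ∈ Finset.Icc (k + 1) sys.N, ((sys.forecast π x0 w v k d (t - k) ω).1 ⬝ᵥ
          (sys.Γ (t + 1) *ᵥ (sys.forecast π x0 w v k d (t - k) ω).1)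
        + (sys.Γ (t + 1) * (sys.forecast π x0 w v k d (t - k) ω).2.1).trace)
      = sys.tailSum k (sys.initOf k d (sys.run π x0 w v k ω).info) := by
  set q : ℕ → ℝ := fun t => (sys.forecast π x0 w v k d (t - (k + 1)) ω).1 ⬝ᵥ
          (sys.Γ t *ᵥ (sys.forecast π x0 w v k d (t - (k + 1)) ω).1)
        + (sys.Γ t * (sys.forecast π x0 w v k d (t - (k + 1)) ω).2.1).trace with hq
  have h1 : ∑ t ∈ Finset.Icc (k + 1) sys.N, q (t + 1) = ∑ t ∈ Finset.Icc (k + 2) sys.N, q t := by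
    have h0 : q (sys.N + 1) = 0 := by simp [hq, Γ_terminal]
    rcases le_or_gt (k + 1) sys.N with hk | hk
    · have e1 : Finset.Icc (k + 1) sys.N = Finset.Ico (k + 1) (sys.N + 1) := by
        ext t; rw [Finset.mem_Icc, Finset.mem_Ico]; omega
      have e2 : Finset.Icc (k + 2) sys.N = Finset.Ico (k + 2) (sys.N + 1) := by
        ext t; rw [Finset.mem_Icc, Finset.mem_Ico]; omega
      rw [e1, e2, Finset.sum_Ico_add' q (k + 1) (sys.N + 1) 1,
        Finset.sum_Ico_succ_top (by omega : k + 1 + 1 ≤ sys.N + 1), h0, add_zero]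
    · rw [Finset.Icc_eq_empty (by omega), Finset.Icc_eq_empty (by omega)]
      simp
  rw [tailSum]
  refine Eq.trans (Finset.sum_congr rfl fun t ht => ?_) h1
  simp only [hq, Nat.add_sub_add_right]

/-- The accumulated prices do not depend on `d`, so they cancel in the value of information. -/
lemma condExp_costToGo (hsys : sys.WellPosed) (hn : sys.IsNoise P x0 w v)
    (hπ : ∀ k, Measurable (π k)) (k : ℕ) (d : Bool) :
    P[sys.costToGo (deviate π (periodicPolicy n p 1) k d) x0 w v k | sys.outputSigma π x0 w v k]
    =ᵐ[P] fun ω => ∑ t ∈ Finset.Icc (k + 1) sys.N, sys.θ t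
      + sys.tailSum k (sys.initOf k d (sys.run π x0 w v k ω).info) := by
  have hdev : ∀ t, Measurable (deviate π (periodicPolicy n p 1) k d t) :=
    measurable_deviate hπ (measurable_periodicPolicy 1) k d
  have e1 : sys.costToGo (deviate π (periodicPolicy n p 1) k d) x0 w v k
      = ∑ t ∈ Finset.Icc (k + 1) sys.N,
        sys.stageLoss (deviate π (periodicPolicy n p 1) k d) x0 w v t := by
    ext ω; rw [costToGo_eq, Finset.sum_apply]
  have h2 : ∀ᵐ ω ∂P, ∀ t ∈ Finset.Icc (k + 1) sys.N,
      P[sys.stageLoss (deviate π (periodicPolicy n p 1) k d) x0 w v t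
        | sys.outputSigma π x0 w v k] ω = sys.θ t
      + ((sys.forecast π x0 w v k d (t - k) ω).1 ⬝ᵥ
          (sys.Γ (t + 1) *ᵥ (sys.forecast π x0 w v k d (t - k) ω).1)
        + (sys.Γ (t + 1) * (sys.forecast π x0 w v k d (t - k) ω).2.1).trace) := by
    rw [ae_all_iff]; intro t
    rw [ae_all_iff]; intro ht
    rw [Finset.mem_Icc] at ht
    filter_upwards [condExp_stageLoss (P := P) hsys hn hπ (by omega : k ≤ t) d] with ω h
    rw [h, if_neg (by omega), mul_one]
  rw [e1]
  filter_upwards [condExp_finsetSum (s := Finset.Icc (k + 1) sys.N)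
    (fun t _ => integrable_stageLoss (P := P) hsys hn hdev t) (sys.outputSigma π x0 w v k), h2]
    with ω h3 h4
  rw [h3, Finset.sum_apply, Finset.sum_congr rfl h4, Finset.sum_add_distrib,
    sum_forecast_eq_tailSum]

lemma voi_ae_eq (hsys : sys.WellPosed) (hn : sys.IsNoise P x0 w v)
    (hπ : ∀ k, Measurable (π k)) (k : ℕ) :
    (fun ω => sys.voi k (sys.run π x0 w v k ω).info)
      =ᵐ[P] fun ω => sys.voiBase k (sys.run π x0 w v k ω).info
        + sys.rolloutRho P π (periodicPolicy n p 1) x0 w v k ω := by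
  filter_upwards [condExp_costToGo (P := P) hsys hn hπ k false,
    condExp_costToGo (P := P) hsys hn hπ k true] with ω h1 h2
  rw [rolloutRho, Pi.sub_apply, h1, h2]
  simp only [voi, initOf, if_true, Bool.false_eq_true, if_false]
  ring

end EventTriggered.LQGSystem

namespace EventTriggered.LQGSystem

variable {n m p : ℕ} {sys : LQGSystem n m p} {Ω : Type*} [mΩ : MeasurableSpace Ω] {P : Measure Ω}
  {x0 : Ω → Fin n → ℝ} {w : ℕ → Ω → Fin n → ℝ} {v : ℕ → Ω → Fin p → ℝ}
  {π base : Policy n p}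

/-! ### Decomposition of the cost -/

/-- The part of the cost that depends on the triggering policy. -/
noncomputable def triggerLoss (sys : LQGSystem n m p) (π : Policy n p) (x0 : Ω → Fin n → ℝ)
    (w : ℕ → Ω → Fin n → ℝ) (v : ℕ → Ω → Fin p → ℝ) (ω : Ω) : ℝ :=
  ∑ t ∈ Finset.range (sys.N + 1), sys.stageLoss π x0 w v t ω

/-- The part of the cost that does not depend on the triggering policy. -/
noncomputable def fixedLoss (sys : LQGSystem n m p) (x0 : Ω → Fin n → ℝ) (w : ℕ → Ω → Fin n → ℝ)
    (ω : Ω) : ℝ :=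
  x0 ω ⬝ᵥ (sys.S 0 *ᵥ x0 ω) + (x0 ω - sys.m₀) ⬝ᵥ (sys.Γ 0 *ᵥ (x0 ω - sys.m₀))
    + ∑ k ∈ Finset.range (sys.N + 1), w k ω ⬝ᵥ (sys.S (k + 1) *ᵥ w k ω)

/-- Product of the process noise at time `k` with the predicted state. -/
noncomputable def crossLoss (sys : LQGSystem n m p) (π : Policy n p) (x0 : Ω → Fin n → ℝ)
    (w : ℕ → Ω → Fin n → ℝ) (v : ℕ → Ω → Fin p → ℝ) (k : ℕ) (ω : Ω) : ℝ :=
  w k ω ⬝ᵥ (sys.S (k + 1) *ᵥ (sys.A k *ᵥ (sys.run π x0 w v k ω).x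
    + sys.B k *ᵥ sys.control k (sys.run π x0 w v k ω).info))

omit mΩ in
-- `stage_cost_eq` is summed along the path: the terms xᵀSx telescope from x0 to the terminal cost,
-- since S_{N+1} = Q_{N+1}.
lemma cost_eq (hsys : sys.WellPosed) (ω : Ω) : sys.cost π x0 w v ω
    = sys.fixedLoss x0 w ω + sys.triggerLoss π x0 w v ω
      + 2 * ∑ k ∈ Finset.range (sys.N + 1), sys.crossLoss π x0 w v k ω := by
  set r := fun k => sys.run π x0 w v k ω with hr
  set u := fun k => sys.control k (r k).info with hu
  set e := fun k => (r k).x - (r k).info.xhat with he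
  set δ : ℕ → ℝ := fun k => sys.θ k * if π k (r k).info then 1 else 0
  have hstep : ∀ k ≤ sys.N, (r k).x ⬝ᵥ (sys.Q k *ᵥ (r k).x) + u k ⬝ᵥ (sys.R k *ᵥ u k)
      = (r k).x ⬝ᵥ (sys.S k *ᵥ (r k).x) - (r (k + 1)).x ⬝ᵥ (sys.S (k + 1) *ᵥ (r (k + 1)).x)
        + e k ⬝ᵥ (sys.Γ k *ᵥ e k) + w k ω ⬝ᵥ (sys.S (k + 1) *ᵥ w k ω)
        + 2 * sys.crossLoss π x0 w v k ω := by
    intro k hk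
    have h1 := stage_cost_eq hsys hk (r k).x (r k).info.xhat (w k ω) (u k) rfl
    have h2 : (r (k + 1)).x = sys.A k *ᵥ (r k).x + sys.B k *ᵥ u k + w k ω := rfl
    rw [h2]
    simp only [crossLoss]
    linarith
  have hsum : ∑ k ∈ Finset.range (sys.N + 1),
        ((r k).x ⬝ᵥ (sys.Q k *ᵥ (r k).x) + u k ⬝ᵥ (sys.R k *ᵥ u k) + δ k)
      = ∑ k ∈ Finset.range (sys.N + 1), (((r k).x ⬝ᵥ (sys.S k *ᵥ (r k).x)
          - (r (k + 1)).x ⬝ᵥ (sys.S (k + 1) *ᵥ (r (k + 1)).x))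
        + e k ⬝ᵥ (sys.Γ k *ᵥ e k) + w k ω ⬝ᵥ (sys.S (k + 1) *ᵥ w k ω)
        + 2 * sys.crossLoss π x0 w v k ω + δ k) :=
    Finset.sum_congr rfl fun k hk => by
      rw [hstep k (Nat.lt_succ_iff.1 (Finset.mem_range.1 hk))]
  have htel := Finset.sum_range_sub' (fun k => (r k).x ⬝ᵥ (sys.S k *ᵥ (r k).x)) (sys.N + 1)
  -- The shift from e_k to e_{k+1} leaves e_0 = x0 - m₀, which no policy affects, and costs nothing
  -- at the end since Γ_{N+1} = 0.
  have hshift : ∑ k ∈ Finset.range (sys.N + 1), e k ⬝ᵥ (sys.Γ k *ᵥ e k)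
      = ∑ k ∈ Finset.range (sys.N + 1), e (k + 1) ⬝ᵥ (sys.Γ (k + 1) *ᵥ e (k + 1))
        + e 0 ⬝ᵥ (sys.Γ 0 *ᵥ e 0) := by
    have h1 := Finset.sum_range_succ (fun k => e k ⬝ᵥ (sys.Γ k *ᵥ e k)) (sys.N + 1)
    have h2 := Finset.sum_range_succ' (fun k => e k ⬝ᵥ (sys.Γ k *ᵥ e k)) (sys.N + 1)
    rw [h1] at h2
    rw [← h2, Γ_terminal]
    simp
  have hcost : sys.cost π x0 w v ω = (r (sys.N + 1)).x ⬝ᵥ (sys.Q (sys.N + 1) *ᵥ (r (sys.N + 1)).x)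
      + ∑ k ∈ Finset.range (sys.N + 1),
        ((r k).x ⬝ᵥ (sys.Q k *ᵥ (r k).x) + u k ⬝ᵥ (sys.R k *ᵥ u k) + δ k) := rfl
  have htrig : sys.triggerLoss π x0 w v ω = ∑ k ∈ Finset.range (sys.N + 1),
      (δ k + e (k + 1) ⬝ᵥ (sys.Γ (k + 1) *ᵥ e (k + 1))) := rfl
  have hr0 : (r 0).x = x0 ω := rfl
  have he0 : e 0 = x0 ω - sys.m₀ := rfl
  rw [hcost, hsum, htrig, fixedLoss, ← S_terminal]
  simp only [Finset.sum_add_distrib, ← Finset.mul_sum]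
  rw [htel, hshift, hr0, he0]
  ring

/-! ### Expected cost and comparison of policies. -/

section Expectation

variable [IsProbabilityMeasure P]

lemma memLp_predicted (hsys : sys.WellPosed) (hn : sys.IsNoise P x0 w v)
    (hπ : ∀ k, Measurable (π k)) (k : ℕ) (i : Fin n) :
    MemLp (fun ω => (sys.S (k + 1) *ᵥ (sys.A k *ᵥ (sys.run π x0 w v k ω).x
      + sys.B k *ᵥ sys.control k (sys.run π x0 w v k ω).info)) i) 2 P :=
  memLp_const_mulVec _ (fun i => (memLp_const_mulVec _ (memLp_run hsys hn hπ k).1 i).add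
    (memLp_const_mulVec _ (memLp_control hsys hn hπ k) i)) i

lemma integrable_crossLoss (hsys : sys.WellPosed) (hn : sys.IsNoise P x0 w v)
    (hπ : ∀ k, Measurable (π k)) (k : ℕ) : Integrable (sys.crossLoss π x0 w v k) P :=
  integrable_dotProduct (hn.isCentred_w hsys k).memLp (memLp_predicted hsys hn hπ k)

/-- State and input at time k depend on the past and v_k, of which the centred w_k is independent.
-/
lemma integral_crossLoss (hsys : sys.WellPosed) (hn : sys.IsNoise P x0 w v)
    (hπ : ∀ k, Measurable (π k)) (k : ℕ) : ∫ ω, sys.crossLoss π x0 w v k ω ∂P = 0 := by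
  have hw := hn.isCentred_w hsys k
  have hle : pastSigma x0 w v k ⊔ MeasurableSpace.comap (v k) inferInstance ≤ mΩ :=
    sup_le (hn.pastSigma_le k) (hn.measurable_v k).comap_le
  obtain ⟨hx, hs⟩ := measurable_run_past (sys := sys) hπ k
    (le_sup_left : pastSigma x0 w v k ≤ pastSigma x0 w v k
      ⊔ MeasurableSpace.comap (v k) inferInstance)
    ((comap_measurable (v k)).mono le_sup_right le_rfl)
  have hm : Measurable[pastSigma x0 w v k ⊔ MeasurableSpace.comap (v k) inferInstance]
      fun ω => sys.S (k + 1) *ᵥ (sys.A k *ᵥ (sys.run π x0 w v k ω).x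
        + sys.B k *ᵥ sys.control k (sys.run π x0 w v k ω).info) :=
    @measurable_mulVec Ω _ _ (_) _ _ _ measurable_const (Measurable.add
      (@measurable_mulVec Ω _ _ (_) _ _ _ measurable_const hx)
      (@measurable_mulVec Ω _ _ (_) _ _ _ measurable_const
        (@measurable_control _ _ _ sys Ω (_) k _ hs)))
  have hmi : ∀ i, Measurable[pastSigma x0 w v k ⊔ MeasurableSpace.comap (v k) inferInstance]
      fun ω => (sys.S (k + 1) *ᵥ (sys.A k *ᵥ (sys.run π x0 w v k ω).x
        + sys.B k *ᵥ sys.control k (sys.run π x0 w v k ω).info)) i := fun i =>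
    Measurable.comp (g := fun f : Fin n → ℝ => f i) (measurable_pi_apply i) hm
  have hL := memLp_predicted (P := P) hsys hn hπ k
  have hI : ∀ i ∈ Finset.univ, Integrable (fun ω => w k ω i *
      (sys.S (k + 1) *ᵥ (sys.A k *ᵥ (sys.run π x0 w v k ω).x
        + sys.B k *ᵥ sys.control k (sys.run π x0 w v k ω).info)) i) P :=
    fun i _ => (hw.memLp i).integrable_mul (hL i)
  simp only [crossLoss, dotProduct]
  rw [integral_finsetSum _ hI]
  refine Finset.sum_eq_zero fun i _ => ?_
  have := hw.condExp_mul_eq_zero bot_le hle (hn.indep_w_past k) (hmi i) (hL i) i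
  rw [condExp_bot] at this
  have h0 : _ = (0 : ℝ) := ae_const_eq this
  simpa only [mul_comm] using h0

omit [IsProbabilityMeasure P] in
lemma integrable_fixedLoss (hsys : sys.WellPosed) (hn : sys.IsNoise P x0 w v) :
    Integrable (sys.fixedLoss x0 w) P :=
  ((integrable_quadratic (memLp_x0 hn) _).add
    (integrable_quadratic (hn.isCentred_x0 hsys).memLp _)).add
    (integrable_finsetSum _ fun k _ => integrable_quadratic (hn.isCentred_w hsys k).memLp _)

lemma integrable_triggerLoss (hsys : sys.WellPosed) (hn : sys.IsNoise P x0 w v)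
    (hπ : ∀ k, Measurable (π k)) : Integrable (sys.triggerLoss π x0 w v) P :=
  integrable_finsetSum _ fun t _ => integrable_stageLoss hsys hn hπ t

lemma integrable_cost (hsys : sys.WellPosed) (hn : sys.IsNoise P x0 w v)
    (hπ : ∀ k, Measurable (π k)) : Integrable (sys.cost π x0 w v) P := by
  rw [funext (cost_eq hsys)]
  exact ((integrable_fixedLoss hsys hn).add (integrable_triggerLoss hsys hn hπ)).add
    ((integrable_finsetSum _ fun k _ => integrable_crossLoss hsys hn hπ k).const_mul 2)

lemma integral_cost (hsys : sys.WellPosed) (hn : sys.IsNoise P x0 w v)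
    (hπ : ∀ k, Measurable (π k)) : ∫ ω, sys.cost π x0 w v ω ∂P
      = ∫ ω, sys.fixedLoss x0 w ω ∂P + ∫ ω, sys.triggerLoss π x0 w v ω ∂P := by
  have h1 := integrable_fixedLoss (P := P) (v := v) hsys hn
  have h2 := integrable_triggerLoss (P := P) hsys hn hπ
  have h3 := fun k => integrable_crossLoss (P := P) hsys hn hπ k
  have h12 : Integrable (fun ω => sys.fixedLoss x0 w ω + sys.triggerLoss π x0 w v ω) P := h1.add h2
  simp only [cost_eq hsys]
  rw [integral_add h12 ((integrable_finsetSum _ fun k _ => h3 k).const_mul 2),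
    integral_add h1 h2, integral_const_mul, integral_finsetSum _ fun k _ => h3 k]
  simp [integral_crossLoss hsys hn hπ]

/-! ### Policy improvement -/

/-- Follow `π` before time `k` and `base` from time `k` on. -/
def switch (π base : Policy n p) (k : ℕ) : Policy n p :=
  fun t s => if t < k then π t s else base t s

omit mΩ [IsProbabilityMeasure P] in
lemma triggerLoss_congr {π' : Policy n p} (ω : Ω)
    (h : ∀ t ≤ sys.N, π t (sys.run π x0 w v t ω).info = π' t (sys.run π x0 w v t ω).info) :
    sys.triggerLoss π x0 w v ω = sys.triggerLoss π' x0 w v ω := by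
  have hrun : ∀ t ≤ sys.N + 1, sys.run π x0 w v t ω = sys.run π' x0 w v t ω := fun t ht =>
    loop_congr sys t fun s hs => h s (by omega)
  refine Finset.sum_congr rfl fun t ht => ?_
  have ht' := Finset.mem_range.1 ht
  rw [stageLoss, stageLoss, ← hrun t (by omega), ← hrun (t + 1) (by omega), h t (by omega)]

omit mΩ [IsProbabilityMeasure P] in
lemma triggerLoss_switch_succ (k : ℕ) (ω : Ω) :
    sys.triggerLoss (switch π base (k + 1)) x0 w v ω
      = sys.triggerLoss (deviate π base k (π k (sys.run π x0 w v k ω).info)) x0 w v ω := by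
  symm
  refine triggerLoss_congr ω fun t _ => ?_
  rcases lt_trichotomy t k with h | rfl | h
  · simp [deviate, switch, h, h.trans k.lt_succ_self]
  · rw [deviate_apply_self, run_deviate le_rfl]
    simp [switch]
  · simp [deviate, switch, h.not_gt, h.ne', show ¬ t < k + 1 by omega]

omit mΩ [IsProbabilityMeasure P] in
-- Period 1 transmits at time k, so both hybrids to be compared become deviations at the same time.
lemma switch_periodic (k : ℕ) : switch π (periodicPolicy n p 1) k
    = deviate π (periodicPolicy n p 1) k true := by
  ext t s
  rcases lt_trichotomy t k with h | rfl | h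
  · simp [deviate, switch, h]
  · simp [deviate, switch, periodicPolicy]
  · simp [deviate, switch, h.not_gt, h.ne']

omit mΩ [IsProbabilityMeasure P] in
-- Stages before time k do not depend on the decision at time k and cancel.
lemma triggerLoss_deviate_sub {k : ℕ} (hk : k ≤ sys.N) (ω : Ω) :
    sys.triggerLoss (deviate π base k false) x0 w v ω
        - sys.triggerLoss (deviate π base k true) x0 w v ω
      = (sys.stageLoss (deviate π base k false) x0 w v k ω
          - sys.stageLoss (deviate π base k true) x0 w v k ω)
        + (sys.costToGo (deviate π base k false) x0 w v k ω
          - sys.costToGo (deviate π base k true) x0 w v k ω) := by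
  have h : ∀ d, sys.triggerLoss (deviate π base k d) x0 w v ω
      = ∑ t ∈ Finset.range k, sys.stageLoss π x0 w v t ω
        + (sys.stageLoss (deviate π base k d) x0 w v k ω
          + sys.costToGo (deviate π base k d) x0 w v k ω) := by
    intro d
    have e1 : Finset.Icc (k + 1) sys.N = Finset.Ico (k + 1) (sys.N + 1) := by
      ext t; rw [Finset.mem_Icc, Finset.mem_Ico]; omega
    rw [triggerLoss, costToGo_eq, e1, Finset.range_eq_Ico,
      ← Finset.sum_Ico_consecutive _ (Nat.zero_le k) (by omega : k ≤ sys.N + 1),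
      Finset.sum_eq_sum_Ico_succ_bot (by omega : k < sys.N + 1), ← Finset.range_eq_Ico]
    congr 1
    refine Finset.sum_congr rfl fun t ht => ?_
    have ht' := Finset.mem_range.1 ht
    rw [stageLoss, stageLoss, run_deviate ht'.le, run_deviate ht']
    simp [deviate, ht']
  rw [h false, h true]
  ring

/-- With a = A_k ε_k and b = K_k ν_k, symmetry of Γ gives aᵀΓa - (a - b)ᵀΓ(a - b) = bᵀΓ(2a - b). The
traces agree, because both decisions start from the same covariance, and the prices differ by -θ_k.
-/
lemma condExp_stageLoss_sub (hsys : sys.WellPosed) (hn : sys.IsNoise P x0 w v)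
    (hπ : ∀ k, Measurable (π k)) (k : ℕ) :
    (fun ω => P[sys.stageLoss (deviate π (periodicPolicy n p 1) k false) x0 w v k
        | sys.outputSigma π x0 w v k] ω
      - P[sys.stageLoss (deviate π (periodicPolicy n p 1) k true) x0 w v k
        | sys.outputSigma π x0 w v k] ω)
    =ᵐ[P] fun ω => sys.voiBase k (sys.run π x0 w v k ω).info := by
  filter_upwards [condExp_stageLoss (P := P) hsys hn hπ le_rfl false,
    condExp_stageLoss (P := P) hsys hn hπ (le_refl k) true] with ω h1 h2
  have hc := dotProduct_mulVec_comm (transpose_Γ hsys (k + 1))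
  rw [h1, h2]
  simp only [Nat.sub_self, forecast, propag, initOf, init0, init1, voiBase, if_true,
    Bool.false_eq_true, if_false, and_true, and_false, Bool.true_eq_false, Matrix.mulVec_sub,
    Matrix.mulVec_smul, dotProduct_sub, sub_dotProduct, dotProduct_smul, smul_eq_mul]
  rw [hc (sys.A k *ᵥ eps (sys.run π x0 w v k ω).info)
    (sys.K k (sys.run π x0 w v k ω).info.P *ᵥ sys.nu k (sys.run π x0 w v k ω).info)]
  ring

/-- The crux of the rule: its sign decides which action has the smaller conditional expected loss
when everything is transmitted afterwards. -/
lemma condExp_triggerLoss_sub (hsys : sys.WellPosed) (hn : sys.IsNoise P x0 w v)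
    (hπ : ∀ k, Measurable (π k)) {k : ℕ} (hk : k ≤ sys.N) :
    P[fun ω => sys.triggerLoss (deviate π (periodicPolicy n p 1) k false) x0 w v ω
        - sys.triggerLoss (deviate π (periodicPolicy n p 1) k true) x0 w v ω
      | sys.outputSigma π x0 w v k]
    =ᵐ[P] fun ω => sys.voi k (sys.run π x0 w v k ω).info := by
  have hdev : ∀ d t, Measurable (deviate π (periodicPolicy n p 1) k d t) :=
    measurable_deviate hπ (measurable_periodicPolicy 1) k
  have s := fun d => integrable_stageLoss (P := P) hsys hn (hdev d) k
  have c := fun d => integrable_costToGo (P := P) hsys hn (hdev d) k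
  have e : (fun ω => sys.triggerLoss (deviate π (periodicPolicy n p 1) k false) x0 w v ω
        - sys.triggerLoss (deviate π (periodicPolicy n p 1) k true) x0 w v ω)
      = (sys.stageLoss (deviate π (periodicPolicy n p 1) k false) x0 w v k
          - sys.stageLoss (deviate π (periodicPolicy n p 1) k true) x0 w v k)
        + (sys.costToGo (deviate π (periodicPolicy n p 1) k false) x0 w v k
          - sys.costToGo (deviate π (periodicPolicy n p 1) k true) x0 w v k) :=
    funext fun ω => triggerLoss_deviate_sub hk ω
  rw [e]
  filter_upwards [condExp_add ((s false).sub (s true)) ((c false).sub (c true))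
      (sys.outputSigma π x0 w v k),
    condExp_sub (s false) (s true) (sys.outputSigma π x0 w v k),
    condExp_sub (c false) (c true) (sys.outputSigma π x0 w v k),
    condExp_stageLoss_sub (P := P) hsys hn hπ k, voi_ae_eq (P := P) hsys hn hπ k]
    with ω h1 h2 h3 h4 h5
  rw [h1, Pi.add_apply, h2, h3, Pi.sub_apply, h4, h5]
  rfl

/-- Deciding by the value of information at time `k` and transmitting always afterwards is not
worse than transmitting always from time `k` on. -/
lemma integral_triggerLoss_switch_le (hsys : sys.WellPosed) (hn : sys.IsNoise P x0 w v) {k : ℕ}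
    (hk : k ≤ sys.N) :
    ∫ ω, sys.triggerLoss (switch sys.rolloutPolicy (periodicPolicy n p 1) (k + 1)) x0 w v ω ∂P
      ≤ ∫ ω, sys.triggerLoss (switch sys.rolloutPolicy (periodicPolicy n p 1) k) x0 w v ω ∂P := by
  set π := sys.rolloutPolicy with hπdef
  have hπ : ∀ k, Measurable (π k) := measurable_rolloutPolicy sys
  have hdev : ∀ d t, Measurable (deviate π (periodicPolicy n p 1) k d t) :=
    measurable_deviate hπ (measurable_periodicPolicy 1) k
  have hI := fun d => integrable_triggerLoss (P := P) hsys hn (hdev d)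
  have hY := outputSigma_le (P := P) (sys := sys) hn hπ k
  set D : Set Ω := {ω | sys.voi k (sys.run π x0 w v k ω).info < 0} with hD
  have hDm : MeasurableSet[sys.outputSigma π x0 w v k] D :=
    (Measurable.comp (measurable_voi sys k) (measurable_info_outputSigma hπ k)) measurableSet_Iio
  set f : Ω → ℝ := fun ω => sys.triggerLoss (deviate π (periodicPolicy n p 1) k false) x0 w v ω
        - sys.triggerLoss (deviate π (periodicPolicy n p 1) k true) x0 w v ω with hf
  have hfI : Integrable f P := (hI false).sub (hI true)
  -- Off `D` the rule transmits, as the periodic policy does, so the two hybrids can differ only on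
  -- `D`.
  have e1 : ∀ ω, sys.triggerLoss (switch π (periodicPolicy n p 1) (k + 1)) x0 w v ω
      = sys.triggerLoss (switch π (periodicPolicy n p 1) k) x0 w v ω + D.indicator f ω := by
    intro ω
    rw [triggerLoss_switch_succ, switch_periodic]
    by_cases hω : ω ∈ D
    · rw [Set.indicator_of_mem hω, hf]
      have : π k (sys.run π x0 w v k ω).info = false := by
        rw [hπdef, rolloutPolicy, decide_eq_false_iff_not, not_le]
        exact hω
      rw [this]
      ring
    · rw [Set.indicator_of_notMem hω]
      have : π k (sys.run π x0 w v k ω).info = true := by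
        rw [hπdef, rolloutPolicy, decide_eq_true_eq]
        exact not_lt.1 hω
      rw [this, add_zero]
  have h2 : ∫ ω in D, f ω ∂P ≤ 0 := by
    -- `D` is known at time k, so on it `f` may be replaced by its conditional expectation, the
    -- value of information, which is negative there.
    rw [← setIntegral_condExp hY hfI hDm]
    have h3 := condExp_triggerLoss_sub (P := P) hsys hn hπ hk
    rw [setIntegral_congr_ae (hY _ hDm) (h3.mono fun ω h _ => h)]
    exact setIntegral_nonpos (hY _ hDm) fun ω hω => le_of_lt hω
  have hsw : Integrable (sys.triggerLoss (switch π (periodicPolicy n p 1) k) x0 w v) P := by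
    rw [switch_periodic]; exact hI true
  simp only [e1]
  rw [integral_add hsw (hfI.indicator (hY _ hDm)), integral_indicator (hY _ hDm)]
  linarith

/-- The chain of hybrids starts at k = 0 with the periodic policy and ends at k = N + 1, where the
hybrid takes the rollout decisions over the whole horizon. -/
lemma integral_triggerLoss_rollout_le (hsys : sys.WellPosed) (hn : sys.IsNoise P x0 w v) :
    ∫ ω, sys.triggerLoss sys.rolloutPolicy x0 w v ω ∂P
      ≤ ∫ ω, sys.triggerLoss (periodicPolicy n p 1) x0 w v ω ∂P := by
  have h : ∀ k ≤ sys.N + 1,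
      ∫ ω, sys.triggerLoss (switch sys.rolloutPolicy (periodicPolicy n p 1) k) x0 w v ω ∂P
        ≤ ∫ ω, sys.triggerLoss (periodicPolicy n p 1) x0 w v ω ∂P := by
    intro k
    induction k with
    | zero => exact fun _ => le_of_eq rfl
    | succ k ih =>
      exact fun hk => (integral_triggerLoss_switch_le hsys hn (by omega)).trans (ih (by omega))
  refine le_trans (le_of_eq (integral_congr_ae (.of_forall fun ω => ?_))) (h (sys.N + 1) le_rfl)
  exact triggerLoss_congr ω fun t ht => by simp [switch, Nat.lt_succ_of_le ht]

lemma condExp_x (hsys : sys.WellPosed) (hn : sys.IsNoise P x0 w v) (hπ : ∀ k, Measurable (π k))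
    (k : ℕ) (i : Fin n) :
    P[fun ω => (sys.run π x0 w v k ω).x i | sys.outputSigma π x0 w v k]
      =ᵐ[P] fun ω => (sys.run π x0 w v k ω).info.xchk i := by
  have h := centredCond_x_sub_xchk (P := P) hsys hn hπ k
  have hY := outputSigma_le (P := P) (sys := sys) hn hπ k
  have hx : Integrable (fun ω => (sys.run π x0 w v k ω).x i) P :=
    ((memLp_run hsys hn hπ k).1 i).integrable one_le_two
  have hm : Measurable[sys.outputSigma π x0 w v k]
      fun ω => (sys.run π x0 w v k ω).info.xchk i :=
    Measurable.comp (measurable_pi_apply i)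
      ((@measurable_info_iff Ω (sys.outputSigma π x0 w v k) _ _ _).1
        (measurable_info_outputSigma hπ k)).2.2.1
  have hc : Integrable (fun ω => (sys.run π x0 w v k ω).info.xchk i) P := by
    refine (hx.sub (h.integrable i)).congr (.of_forall fun ω => ?_)
    simp
  have e : (fun ω => (sys.run π x0 w v k ω).x i)
      = (fun ω => ((sys.run π x0 w v k ω).x - (sys.run π x0 w v k ω).info.xchk) i)
        + fun ω => (sys.run π x0 w v k ω).info.xchk i := by
    ext ω; simp
  rw [e]
  filter_upwards [condExp_add (h.integrable i) hc (sys.outputSigma π x0 w v k), h.mean i]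
    with ω h1 h2
  rw [h1, Pi.add_apply, h2, condExp_of_stronglyMeasurable hY hm.stronglyMeasurable hc]
  simp

end Expectation

end EventTriggered.LQGSystem



theorem proposition5 {n m p : ℕ} (sys : LQGSystem n m p) (hsys : sys.WellPosed)
    {Ω : Type*} [MeasurableSpace Ω] (P : Measure Ω) [IsProbabilityMeasure P]
    (x0 : Ω → Fin n → ℝ) (w : ℕ → Ω → Fin n → ℝ) (v : ℕ → Ω → Fin p → ℝ)
    (hnoise : sys.IsNoise P x0 w v) :
    -- the filter of the event trigger computes the conditional mean and covariance of the state
    (∀ k ≤ sys.N,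
      (∀ i, MemLp (fun ω => (sys.run sys.rolloutPolicy x0 w v k ω).x i) 2 P) ∧
      (∀ i, P[fun ω => (sys.run sys.rolloutPolicy x0 w v k ω).x i
            | sys.outputSigma sys.rolloutPolicy x0 w v k]
          =ᵐ[P] fun ω => (sys.run sys.rolloutPolicy x0 w v k ω).info.xchk i) ∧
      (∀ i j, P[fun ω =>
              ((sys.run sys.rolloutPolicy x0 w v k ω).x i
                - (sys.run sys.rolloutPolicy x0 w v k ω).info.xchk i)
              * ((sys.run sys.rolloutPolicy x0 w v k ω).x j
                - (sys.run sys.rolloutPolicy x0 w v k ω).info.xchk j)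
            | sys.outputSigma sys.rolloutPolicy x0 w v k]
          =ᵐ[P] fun _ => sys.Sig k i j)) ∧
    -- the policy is admissible, and its index is the value of information that the rollout
    -- algorithm with the periodic base policy of period 1 prescribes
    (∀ k ≤ sys.N,
      Measurable[sys.outputSigma sys.rolloutPolicy x0 w v k]
        (fun ω => sys.rolloutPolicy k (sys.run sys.rolloutPolicy x0 w v k ω).info) ∧
      (∀ d : Bool, Integrable
        (sys.costToGo (deviate sys.rolloutPolicy (periodicPolicy n p 1) k d) x0 w v k) P) ∧
      (fun ω => sys.voi k (sys.run sys.rolloutPolicy x0 w v k ω).info)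
        =ᵐ[P] fun ω => sys.voiBase k (sys.run sys.rolloutPolicy x0 w v k ω).info
          + sys.rolloutRho P sys.rolloutPolicy (periodicPolicy n p 1) x0 w v k ω) ∧
    -- the policy outperforms the periodic policy of period 1
    Integrable (sys.cost sys.rolloutPolicy x0 w v) P ∧
    Integrable (sys.cost (periodicPolicy n p 1) x0 w v) P ∧
    ∫ ω, sys.cost sys.rolloutPolicy x0 w v ω ∂P
      ≤ ∫ ω, sys.cost (periodicPolicy n p 1) x0 w v ω ∂P := by
  have hπ : ∀ k, Measurable (sys.rolloutPolicy k) := measurable_rolloutPolicy sys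
  have hbase : ∀ k, Measurable (periodicPolicy n p 1 k) := measurable_periodicPolicy 1
  refine ⟨fun k _ => ⟨(memLp_run hsys hnoise hπ k).1, condExp_x hsys hnoise hπ k,
      (centredCond_x_sub_xchk hsys hnoise hπ k).cov⟩, fun k _ => ⟨?_, fun d => ?_, ?_⟩, ?_, ?_, ?_⟩
  · exact Measurable.comp (hπ k) (measurable_info_outputSigma hπ k)
  · exact integrable_costToGo hsys hnoise (measurable_deviate hπ hbase k d) k
  · exact voi_ae_eq hsys hnoise hπ k
  · exact integrable_cost hsys hnoise hπ
  · exact integrable_cost hsys hnoise hbase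
  · rw [integral_cost hsys hnoise hπ, integral_cost hsys hnoise hbase]
    exact add_le_add le_rfl (integral_triggerLoss_rollout_le hsys hnoise)
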